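/- Let $a>0$, $\rho_a=\sqrt a/(1+\sqrt a)$, and let $\phi=(\phi_z)_{z\in\mathbb Z}$ be a (deterministic or random) down-right lattice path, i.e. $\phi_0=\mathbf 0$ and $\phi_{z+1}-\phi_z\in\{-\mathbf e_2,\mathbf e_1\}$. Call $\phi_z$ a concave corner if $\phi_z-\phi_{z-1}=-\mathbf e_2$ and $\phi_{z+1}-\phi_z=\mathbf e_1$. Assume that a.s. the origin is a concave corner and there are infinitely many concave corners on each side of it, and let $\dots<z_{-1}<z_0=0<z_1<\dots$ enumerate the indices of the concave corners. Let $\mathrm{Exp}_z(\rho_a)$, $\mathrm{Exp}'_z(1-\rho_a)$, $z\in\mathbb Z$, be independent exponential variables with the indicated rates, independent of $\phi$. For $z\ge1$ let $X_z=-\mathrm{Exp}'_z$ if $\phi_z-\phi_{z-1}=\mathbf e_1$ and $X_z=\mathrm{Exp}_z$ if $\phi_z-\phi_{z-1}=-\mathbf e_2$; for $z\le0$ let $X_z=\mathrm{Exp}'_z$ if $\phi_{z-1}-\phi_z=-\mathbf e_1$ and $X_z=-\mathrm{Exp}_z$ if $\phi_{z-1}-\phi_z=\mathbf e_2$. Put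 $S(0)=0$, $S(z)=\sum_{k=1}^zX_k$ for $z>0$, $S(z)=\sum_{k=z+1}^{0}X_k$ for $z<0$, and $$X_n^{\pm}=S(z_{\pm n})-S(z_{\pm(n-1)}),\qquad S_n^\pm=\sum_{k=1}^nX_k^\pm\quad(n\ge1),\qquad M_a=\max_{z\in\mathbb Z}S(z),$$ and let $Z_a=k$ if the maximum is attained at $z_k$. Assume that $(X_n^+)_{n\ge1}$ and $(X_n^-)_{n\ge1}$ are independent of each other and that each of them is an i.i.d. sequence. Assume also that, for some constants $c,\gamma^\pm,\delta^\pm>0$: $\mathbb E(e^{uX_1^\pm})<\infty$ for all $u\in[0,c]$; $\gamma^\pm$ is the minimal positive number with $\mathbb E(e^{\gamma^\pm X_1^\pm})=1$; $b^\pm:=\mathbb P(X_1^\pm>0)>0$; and on $(0,\infty)$ the law of $X_1^\pm$ has the density $b^\pm\delta^\pm e^{-\delta^\pm x}$. Then a.s. the maximum $M_a$ is attained and there is exactly one concave corner at which it is attained. For all $s\in(0,1)$ and $u\in[0,c]$, the expectation $\mathbb E(s^{|Z_a|}e^{uM_a})$ is finite if and only if $s\,\mathbb E(e^{uX_1^+})<1$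 and $s\,\mathbb E(e^{uX_1^-})<1$, and in this case $$\mathbb E\big(s^{|Z_a|}e^{uM_a}\big)=\frac{\gamma^+}{\delta^+}\frac{\gamma^-}{\delta^-}+\phi_a^+(s,u)-\Big(1-\frac{\gamma^-}{\delta^-}\Big)\phi_a^+(s,u-\gamma^-)+\phi_a^-(s,u)-\Big(1-\frac{\gamma^+}{\delta^+}\Big)\phi_a^-(s,u-\gamma^+),$$ where, with $x^*=\max\{0,x\}$, $$\phi_a^\pm(s,v)=\frac{\gamma^\pm}{\delta^\pm}\Big(\exp\Big\{\sum_{n=1}^\infty\frac{s^n}{n}\Big(\mathbb E\big(e^{v(S_n^\pm)^*}\big)-\mathbb P(S_n^\pm\le0)\Big)\Big\}-1\Big),$$ all four series involved being convergent. -/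

import Mathlib

open Filter Topology MeasureTheory ProbabilityTheory

/-- `φ` is a down-right nearest-neighbour bi-infinite lattice path through the origin. -/
def IsSubstrate (φ : ℤ → ℤ × ℤ) : Prop :=
  φ 0 = 0 ∧ ∀ z : ℤ, φ (z + 1) - φ z = (0, -1) ∨ φ (z + 1) - φ z = (1, 0)

/-- `φ z` is a concave corner: the path arrives by a down step and leaves by a right step. -/
def IsConcaveCorner (φ : ℤ → ℤ × ℤ) (z : ℤ) : Prop :=
  φ z - φ (z - 1) = (0, -1) ∧ φ (z + 1) - φ z = (1, 0)

/-- The ordered enumeration `⋯ < z₋₁ < z₀ = 0 < z₁ < ⋯` of the indices of the concave corners of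
a path which has a concave corner at the origin and infinitely many of them on each side. -/
noncomputable def corner (φ : ℤ → ℤ × ℤ) (k : ℤ) : ℤ :=
  if 0 ≤ k then (Nat.nth (fun j : ℕ => IsConcaveCorner φ (j : ℤ)) k.natAbs : ℤ)
  else -(Nat.nth (fun j : ℕ => IsConcaveCorner φ (-(j : ℤ))) k.natAbs : ℤ)

/-- The parameter `ρ_a = √a / (1 + √a)`. -/
noncomputable def rhoParam (a : ℝ) : ℝ := Real.sqrt a / (1 + Real.sqrt a)

open Classical in
/-- The increment `X_z` along the edge between `φ (z - 1)` and `φ z`, read away from the origin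
(from `φ (z - 1)` to `φ z` if `z ≥ 1`, from `φ z` to `φ (z - 1)` if `z ≤ 0`). -/
noncomputable def edgeIncrement (φ : ℤ → ℤ × ℤ) (ξ ξ' : ℤ → ℝ) (z : ℤ) : ℝ :=
  if 1 ≤ z then
    (if φ z - φ (z - 1) = (1, 0) then -ξ' z else ξ z)
  else
    (if φ (z - 1) - φ z = (-1, 0) then ξ' z else -ξ z)

/-- The two-sided random walk along the path: `S(z) = X_1 + ⋯ + X_z` for `z ≥ 0` and
`S(z) = X_0 + X_{-1} + ⋯ + X_{z+1}` for `z ≤ 0`. -/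
noncomputable def substrateWalk (φ : ℤ → ℤ × ℤ) (ξ ξ' : ℤ → ℝ) (z : ℤ) : ℝ :=
  if 0 ≤ z then ∑ k ∈ Finset.Ioc 0 z, edgeIncrement φ ξ ξ' k
  else ∑ k ∈ Finset.Ioc z 0, edgeIncrement φ ξ ξ' k

/-- The steps of the one-sided walks observed at the concave corners, indexed from `0`:
`cornerStep φ ξ ξ' 1 n` is `X⁺_{n+1} = S(z_{n+1}) - S(z_n)` and
`cornerStep φ ξ ξ' (-1) n` is `X⁻_{n+1} = S(z_{-(n+1)}) - S(z_{-n})`. -/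
noncomputable def cornerStep (φ : ℤ → ℤ × ℤ) (ξ ξ' : ℤ → ℝ) (side : ℤ) (n : ℕ) : ℝ :=
  substrateWalk φ ξ ξ' (corner φ (side * ((n : ℤ) + 1))) -
    substrateWalk φ ξ ξ' (corner φ (side * (n : ℤ)))

/-- The global maximum `M_a` of the two-sided walk. -/
noncomputable def globalMax (φ : ℤ → ℤ × ℤ) (ξ ξ' : ℤ → ℝ) : ℝ :=
  ⨆ z : ℤ, substrateWalk φ ξ ξ' z

/-- The two-sided walk attains its global maximum at the `k`-th concave corner. -/
def IsMaxCorner (φ : ℤ → ℤ × ℤ) (ξ ξ' : ℤ → ℝ) (k : ℤ) : Prop :=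
  ∀ z : ℤ, substrateWalk φ ξ ξ' z ≤ substrateWalk φ ξ ξ' (corner φ k)

open Classical in
/-- The location `Z_a`: the number of the concave corner at which the two-sided walk attains its
maximum (and `0` if there is none). -/
noncomputable def globalArgmax (φ : ℤ → ℤ × ℤ) (ξ ξ' : ℤ → ℝ) : ℤ :=
  if h : ∃ k : ℤ, IsMaxCorner φ ξ ξ' k then h.choose else 0

/-- The partial sums `S_n` of a sequence of steps (the `(n+1)`-st step being `X n`). -/
def partialSum {Ω : Type*} (X : ℕ → Ω → ℝ) (n : ℕ) (ω : Ω) : ℝ :=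
  ∑ k ∈ Finset.range n, X k ω

/-- The assumptions on the distribution of a step `X`: finite exponential moments on `[0, c]`,
an exponential right tail with parameter `δ`, and `γ` is the minimal positive solution of
`E e^{γ X} = 1`. -/
structure StepAssumptions {Ω : Type*} [MeasurableSpace Ω] (P : Measure Ω) (X : Ω → ℝ)
    (c γ δ : ℝ) : Prop where
  exp_moment : ∀ u ∈ Set.Icc 0 c, Integrable (fun ω => Real.exp (u * X ω)) P
  delta_pos : 0 < δ
  prob_pos : 0 < P.real {ω | 0 < X ω}
  right_tail : (P.map X).restrict (Set.Ioi 0) =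
    (volume.restrict (Set.Ioi 0)).withDensity
      (fun x => ENNReal.ofReal (P.real {ω | 0 < X ω} * δ * Real.exp (-(δ * x))))
  gamma_least : IsLeast {θ : ℝ | 0 < θ ∧ Integrable (fun ω => Real.exp (θ * X ω)) P ∧
    ∫ ω, Real.exp (θ * X ω) ∂P = 1} γ

/-- The `n`-th term `(sⁿ / n) (E e^{u S_n^*} - P(S_n ≤ 0))`, where `x^* = max {0, x}`. -/
noncomputable def exponentTerm {Ω : Type*} [MeasurableSpace Ω] (P : Measure Ω)
    (X : ℕ → Ω → ℝ) (s u : ℝ) (n : ℕ) : ℝ :=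
  s ^ n / (n : ℝ) * ((∫ ω, Real.exp (u * max 0 (partialSum X n ω)) ∂P) -
    P.real {ω | partialSum X n ω ≤ 0})

/-- `φ(s, u) = (γ / δ) (exp {∑_{n ≥ 1} (sⁿ / n) (E e^{u S_n^*} - P(S_n ≤ 0))} - 1)`. -/
noncomputable def phiTransform {Ω : Type*} [MeasurableSpace Ω] (P : Measure Ω)
    (X : ℕ → Ω → ℝ) (γ δ s u : ℝ) : ℝ :=
  γ / δ * (Real.exp (∑' n : ℕ, exponentTerm P X s u (n + 1)) - 1)

/-! Read away from the origin, the walk along the path rises and then falls between turns, and its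
local maxima are concave corners. The two-sided maximum is therefore that of two independent random
walks observed at corners (`IsGoodPath.exists_corner_ge`). Each first step contains an exponential
variable independent of its other summands, so step laws have no atoms; together with drift to minus
infinity this gives a unique maximiser (`IsRegularPair.existsUnique_max`).

A walk first attains its maximum at time n exactly when n is a strict record and the walk after n
never exceeds its value there. These conditions involve disjoint blocks of steps. If M' is the
maximum of the other walk, with parameters γ', δ', the side on which the maximum lies at distance n
≥ 1 thus contributes s^n E[e^{u S_n} P(M' ≤ S_n); n record] P(max = 0). The exponential right tail
is memoryless, so the overshoot at first passage is again exponential, and stopping e^{γ S} there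
gives P(max ≤ x) = 1 - (1 - γ/δ) e^{-γ x} (`IsStepLaw.measure_forall_walk_le`). Inserting this
produces transforms at u and at u - γ', and the case of both maxima being zero gives the constant
term.

There remains R(s, v) = ∑ s^n E[e^{v S_n}; n record], called `recordGen`. Splitting at the first
maximum factors the laws of S_n into record laws and laws of walks kept nonpositive. In the semiring
of finite measures under convolution, the logarithmic derivative of ∑ w_n z^n is ∑ w_{n+1} z^n,
where w_n is the law of S_n. Restriction to the positive half-line assigns its two parts to the two
factors, which is Spitzer's identity (`sum_posPart_walkLaw_conv_recordLaw`). Integrating it gives R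
= exp ∑ s^n/n E[e^{v S_n}; S_n > 0] (`exp_tsum_eq_recordGen`).

The same factorization decides finiteness: for u ≥ 0 and s < 1 the nonpositive factor lies between 1
and a finite constant, so R is finite exactly when the geometric series in s E e^{u X} converges
(`recordGen_lt_top_iff`). -/

namespace RandomWalk

open scoped ENNReal

/-! ### Path space of an i.i.d. sequence and the decomposition at the first maximum -/

/-- The partial sums of a real sequence. -/
def walk (x : ℕ → ℝ) (n : ℕ) : ℝ := ∑ k ∈ Finset.range n, x k

/-- The first `n` terms of `x` followed by `y`. -/
def splice (n : ℕ) (x y : ℕ → ℝ) : ℕ → ℝ := fun k => if k < n then x k else y (k - n)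

/-- The law of an i.i.d. sequence with marginal `μ`. -/
noncomputable def seqLaw (μ : Measure ℝ) : Measure (ℕ → ℝ) := Measure.infinitePi (fun _ => μ)

@[simp] lemma walk_zero (x : ℕ → ℝ) : walk x 0 = 0 := by simp [walk]

lemma walk_succ (x : ℕ → ℝ) (n : ℕ) : walk x (n + 1) = walk x n + x n := by
  simp [walk, Finset.sum_range_succ]

lemma walk_one (x : ℕ → ℝ) : walk x 1 = x 0 := by simp [walk]

@[fun_prop]
lemma measurable_walk (n : ℕ) : Measurable (fun x : ℕ → ℝ => walk x n) := by
  unfold walk; fun_prop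

lemma walk_splice_of_le {n j : ℕ} (h : j ≤ n) (x y : ℕ → ℝ) :
    walk (splice n x y) j = walk x j := by
  unfold walk splice
  refine Finset.sum_congr rfl fun k hk => ?_
  rw [if_pos ((Finset.mem_range.1 hk).trans_le h)]

lemma walk_splice_add (n m : ℕ) (x y : ℕ → ℝ) :
    walk (splice n x y) (n + m) = walk x n + walk y m := by
  rw [walk, Finset.sum_range_add]
  congr 1
  · exact walk_splice_of_le le_rfl x y
  · simp [walk, splice]

@[fun_prop]
lemma measurable_splice (n : ℕ) :
    Measurable (fun p : (ℕ → ℝ) × (ℕ → ℝ) => splice n p.1 p.2) := by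
  refine measurable_pi_lambda _ fun k => ?_
  unfold splice
  by_cases h : k < n
  · simp only [h, if_true]; fun_prop
  · simp only [h, if_false]; fun_prop

variable (μ : Measure ℝ) [IsProbabilityMeasure μ]

instance : IsProbabilityMeasure (seqLaw μ) := by unfold seqLaw; infer_instance

/-- The Markov property at a fixed time: the steps after n may be resampled independently of the
first n. On cylinder sets the index set splits at n and the product measure factors. -/
lemma seqLaw_map_splice (n : ℕ) :
    ((seqLaw μ).prod (seqLaw μ)).map (fun p => splice n p.1 p.2) = seqLaw μ := by
  refine Measure.eq_infinitePi _ fun s t ht => ?_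
  have hpre : (fun p : (ℕ → ℝ) × (ℕ → ℝ) => splice n p.1 p.2) ⁻¹' ((s : Set ℕ).pi t) =
      (((s.filter (· < n) : Finset ℕ) : Set ℕ).pi t) ×ˢ
        ((((s.filter (¬ · < n)).image (· - n) : Finset ℕ) : Set ℕ).pi fun k => t (k + n)) := by
    ext ⟨x, y⟩
    simp only [Set.mem_preimage, Set.mem_pi, Set.mem_prod, Finset.mem_coe, Finset.mem_filter,
      Finset.mem_image, splice]
    constructor
    · intro h
      refine ⟨fun i hi => by simpa [hi.2] using h i hi.1, ?_⟩
      rintro _ ⟨i, hi, rfl⟩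
      have := h i hi.1
      rw [if_neg hi.2] at this
      rwa [Nat.sub_add_cancel (not_lt.1 hi.2)]
    · rintro ⟨h1, h2⟩ i hi
      by_cases hin : i < n
      · simpa [hin] using h1 i ⟨hi, hin⟩
      · have := h2 (i - n) ⟨i, ⟨hi, hin⟩, rfl⟩
        rw [Nat.sub_add_cancel (not_lt.1 hin)] at this
        simpa [hin] using this
  rw [Measure.map_apply (measurable_splice n)
    (MeasurableSet.pi s.countable_toSet fun i _ => ht i), hpre, Measure.prod_prod, seqLaw,
    Measure.infinitePi_pi _ (fun i _ => ht i), Measure.infinitePi_pi _ (fun i _ => ht (i + n)),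
    Finset.prod_image]
  · rw [← Finset.prod_filter_mul_prod_filter_not s (· < n)]
    congr 1
    refine Finset.prod_congr rfl fun i hi => ?_
    rw [Nat.sub_add_cancel (not_lt.1 (Finset.mem_filter.1 hi).2)]
  · intro i hi j hj hij
    have h1 := (Finset.mem_filter.1 hi).2
    have h2 := (Finset.mem_filter.1 hj).2
    simp only at hij
    omega

lemma lintegral_splice (n : ℕ) {f : (ℕ → ℝ) → ℝ≥0∞} (hf : Measurable f) :
    ∫⁻ z, f z ∂seqLaw μ = ∫⁻ x, ∫⁻ y, f (splice n x y) ∂seqLaw μ ∂seqLaw μ := by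
  conv_lhs => rw [← seqLaw_map_splice μ n]
  rw [lintegral_map hf (measurable_splice n), lintegral_prod]
  exact (hf.comp (measurable_splice n)).aemeasurable

lemma seqLaw_map_eval (n : ℕ) : (seqLaw μ).map (fun x => x n) = μ :=
  Measure.infinitePi_map_eval (fun _ => μ) n

lemma lintegral_eval (n : ℕ) {f : ℝ → ℝ≥0∞} (hf : Measurable f) :
    ∫⁻ x, f (x n) ∂seqLaw μ = ∫⁻ t, f t ∂μ := by
  conv_rhs => rw [← seqLaw_map_eval μ n]
  rw [lintegral_map hf (by fun_prop)]

/-- `n` is a strict record time of the walk. -/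
def recordSet (n : ℕ) : Set (ℕ → ℝ) := {x | ∀ j < n, walk x j < walk x n}

/-- The walk stays nonpositive up to time `n`. -/
def nonposSet (n : ℕ) : Set (ℕ → ℝ) := {x | ∀ j ≤ n, walk x j ≤ 0}

/-- The walk stays nonpositive forever. -/
def nonposAlways : Set (ℕ → ℝ) := {x | ∀ j, walk x j ≤ 0}

/-- `i` is the first time at which the walk attains its maximum up to time `n`. -/
def firstMaxSet (i n : ℕ) : Set (ℕ → ℝ) :=
  {x | (∀ k < i, walk x k < walk x i) ∧ ∀ k, i ≤ k → k ≤ n → walk x k ≤ walk x i}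

/-- `n` is the first time at which the walk attains its global maximum. -/
def firstArgmax (n : ℕ) : Set (ℕ → ℝ) :=
  {x | (∀ k < n, walk x k < walk x n) ∧ ∀ k, n ≤ k → walk x k ≤ walk x n}

lemma measurableSet_recordSet (n : ℕ) : MeasurableSet (recordSet n) := by
  simp only [recordSet, Set.ofPred_forall]
  refine MeasurableSet.iInter fun j => MeasurableSet.iInter fun _ => ?_
  exact measurableSet_lt (by fun_prop) (by fun_prop)

lemma measurableSet_nonposSet (n : ℕ) : MeasurableSet (nonposSet n) := by
  simp only [nonposSet, Set.ofPred_forall]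
  refine MeasurableSet.iInter fun j => MeasurableSet.iInter fun _ => ?_
  exact measurableSet_le (by fun_prop) (by fun_prop)

lemma measurableSet_nonposAlways : MeasurableSet nonposAlways := by
  simp only [nonposAlways, Set.ofPred_forall]
  refine MeasurableSet.iInter fun j => ?_
  exact measurableSet_le (by fun_prop) (by fun_prop)

lemma measurableSet_firstMaxSet (i n : ℕ) : MeasurableSet (firstMaxSet i n) := by
  simp only [firstMaxSet, Set.ofPred_and, Set.ofPred_forall]
  refine MeasurableSet.inter ?_ ?_
  · refine MeasurableSet.iInter fun j => MeasurableSet.iInter fun _ => ?_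
    exact measurableSet_lt (by fun_prop) (by fun_prop)
  · refine MeasurableSet.iInter fun j => MeasurableSet.iInter fun _ =>
      MeasurableSet.iInter fun _ => ?_
    exact measurableSet_le (by fun_prop) (by fun_prop)

lemma measurableSet_firstArgmax (n : ℕ) : MeasurableSet (firstArgmax n) := by
  simp only [firstArgmax, Set.ofPred_and, Set.ofPred_forall]
  refine MeasurableSet.inter ?_ ?_
  · refine MeasurableSet.iInter fun j => MeasurableSet.iInter fun _ => ?_
    exact measurableSet_lt (by fun_prop) (by fun_prop)
  · refine MeasurableSet.iInter fun j => MeasurableSet.iInter fun _ => ?_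
    exact measurableSet_le (by fun_prop) (by fun_prop)

/-- Strict inequalities before i and weak ones after it select the first maximiser. They constrain
the prefix and the suffix separately, so the event becomes a product. -/
lemma splice_mem_firstMaxSet (i j : ℕ) (x y : ℕ → ℝ) :
    splice i x y ∈ firstMaxSet i (i + j) ↔ x ∈ recordSet i ∧ y ∈ nonposSet j := by
  simp only [firstMaxSet, recordSet, nonposSet, Set.mem_ofPred_eq]
  refine and_congr (forall₂_congr fun k hk => ?_) ⟨fun h m hm => ?_, fun h k hk hkn => ?_⟩
  · rw [walk_splice_of_le hk.le, walk_splice_of_le le_rfl]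
  · have := h (i + m) (by omega) (by omega)
    rw [walk_splice_add, walk_splice_of_le le_rfl] at this
    linarith
  · obtain ⟨m, rfl⟩ := Nat.exists_eq_add_of_le hk
    rw [walk_splice_add, walk_splice_of_le le_rfl]
    linarith [h m (by omega)]

lemma splice_mem_firstArgmax (i : ℕ) (x y : ℕ → ℝ) :
    splice i x y ∈ firstArgmax i ↔ x ∈ recordSet i ∧ y ∈ nonposAlways := by
  simp only [firstArgmax, recordSet, nonposAlways, Set.mem_ofPred_eq]
  refine and_congr (forall₂_congr fun k hk => ?_) ⟨fun h m => ?_, fun h k hk => ?_⟩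
  · rw [walk_splice_of_le hk.le, walk_splice_of_le le_rfl]
  · have := h (i + m) (by omega)
    rw [walk_splice_add, walk_splice_of_le le_rfl] at this
    linarith
  · obtain ⟨m, rfl⟩ := Nat.exists_eq_add_of_le hk
    rw [walk_splice_add, walk_splice_of_le le_rfl]
    linarith [h m]

lemma exists_mem_firstMaxSet (x : ℕ → ℝ) (n : ℕ) : ∃ i ≤ n, x ∈ firstMaxSet i n := by
  have hex : ∃ i, i ≤ n ∧ ∀ k ≤ n, walk x k ≤ walk x i := by
    obtain ⟨i, hi, h⟩ := Finset.exists_max_image (Finset.range (n + 1)) (walk x) ⟨0, by simp⟩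
    exact ⟨i, by simpa [Nat.lt_succ_iff] using hi, fun k hk => h k (by simpa [Nat.lt_succ_iff] using hk)⟩
  classical
  refine ⟨Nat.find hex, (Nat.find_spec hex).1, fun k hk => ?_,
    fun k _ hk => (Nat.find_spec hex).2 k hk⟩
  by_contra hcon
  have hkn : k ≤ n := hk.le.trans (Nat.find_spec hex).1
  exact Nat.find_min hex hk ⟨hkn, fun l hl => ((Nat.find_spec hex).2 l hl).trans (not_lt.1 hcon)⟩

lemma eq_of_mem_firstMaxSet {x : ℕ → ℝ} {n i j : ℕ} (hi : i ≤ n) (hj : j ≤ n)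
    (hxi : x ∈ firstMaxSet i n) (hxj : x ∈ firstMaxSet j n) : i = j := by
  rcases lt_trichotomy i j with h | h | h
  · exact absurd (hxj.1 i h) (not_lt.2 (hxi.2 j h.le hj))
  · exact h
  · exact absurd (hxi.1 j h) (not_lt.2 (hxj.2 i h.le hi))

/-- The law of `S_n`. -/
noncomputable def walkLaw (n : ℕ) : Measure ℝ := (seqLaw μ).map (fun x => walk x n)

/-- The law of `S_n` on the event that `n` is a strict record time. -/
noncomputable def recordLaw (n : ℕ) : Measure ℝ :=
  ((seqLaw μ).restrict (recordSet n)).map (fun x => walk x n)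

/-- The law of `S_n` on the event that the walk stays nonpositive up to time `n`. -/
noncomputable def nonposLaw (n : ℕ) : Measure ℝ :=
  ((seqLaw μ).restrict (nonposSet n)).map (fun x => walk x n)

instance (n : ℕ) : IsProbabilityMeasure (walkLaw μ n) :=
  Measure.isProbabilityMeasure_map (by fun_prop)

instance (n : ℕ) : IsFiniteMeasure (recordLaw μ n) := by
  unfold recordLaw; infer_instance

instance (n : ℕ) : IsFiniteMeasure (nonposLaw μ n) := by
  unfold nonposLaw; infer_instance

omit [IsProbabilityMeasure μ] in
lemma lintegral_walkLaw (n : ℕ) {f : ℝ → ℝ≥0∞} (hf : Measurable f) :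
    ∫⁻ t, f t ∂walkLaw μ n = ∫⁻ x, f (walk x n) ∂seqLaw μ := by
  rw [walkLaw, lintegral_map hf (by fun_prop)]

omit [IsProbabilityMeasure μ] in
lemma lintegral_recordLaw (n : ℕ) {f : ℝ → ℝ≥0∞} (hf : Measurable f) :
    ∫⁻ t, f t ∂recordLaw μ n =
      ∫⁻ x, (recordSet n).indicator (fun x => f (walk x n)) x ∂seqLaw μ := by
  rw [recordLaw, lintegral_map hf (by fun_prop), lintegral_indicator (measurableSet_recordSet n)]

omit [IsProbabilityMeasure μ] in
lemma lintegral_nonposLaw (n : ℕ) {f : ℝ → ℝ≥0∞} (hf : Measurable f) :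
    ∫⁻ t, f t ∂nonposLaw μ n =
      ∫⁻ x, (nonposSet n).indicator (fun x => f (walk x n)) x ∂seqLaw μ := by
  rw [nonposLaw, lintegral_map hf (by fun_prop), lintegral_indicator (measurableSet_nonposSet n)]

lemma walkLaw_zero : walkLaw μ 0 = Measure.dirac 0 := by
  simp [walkLaw, Measure.map_const]

lemma recordLaw_zero : recordLaw μ 0 = Measure.dirac 0 := by
  have : recordSet 0 = Set.univ := by ext; simp [recordSet]
  simp [recordLaw, this, Measure.map_const]

lemma nonposLaw_zero : nonposLaw μ 0 = Measure.dirac 0 := by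
  have : nonposSet 0 = Set.univ := by ext; simp [nonposSet]
  simp [nonposLaw, this, Measure.map_const]

lemma walkLaw_conv (i j : ℕ) : walkLaw μ i ∗ walkLaw μ j = walkLaw μ (i + j) := by
  refine Measure.ext_of_lintegral _ fun f hf => ?_
  rw [Measure.lintegral_conv hf, lintegral_walkLaw μ i, lintegral_walkLaw μ (i + j) hf,
    lintegral_splice μ i (f := fun z => f (walk z (i + j))) (by fun_prop)]
  · refine lintegral_congr fun x => ?_
    rw [lintegral_walkLaw μ j (by fun_prop)]
    simp only [walk_splice_add]
  · exact Measurable.lintegral_prod_right' (f := fun p : ℝ × ℝ => f (p.1 + p.2)) (by fun_prop)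

lemma lintegral_recordLaw_conv_nonposLaw (i j : ℕ) {f : ℝ → ℝ≥0∞} (hf : Measurable f) :
    ∫⁻ t, f t ∂(recordLaw μ i ∗ nonposLaw μ j) =
      ∫⁻ z, (firstMaxSet i (i + j)).indicator (fun z => f (walk z (i + j))) z ∂seqLaw μ := by
  rw [Measure.lintegral_conv hf, lintegral_recordLaw μ i, lintegral_splice μ i
    (f := (firstMaxSet i (i + j)).indicator (fun z => f (walk z (i + j))))]
  · refine lintegral_congr fun x => ?_
    by_cases hx : x ∈ recordSet i
    · rw [Set.indicator_of_mem hx, lintegral_nonposLaw μ j (by fun_prop)]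
      refine lintegral_congr fun y => ?_
      by_cases hy : y ∈ nonposSet j
      · rw [Set.indicator_of_mem hy,
          Set.indicator_of_mem ((splice_mem_firstMaxSet i j x y).2 ⟨hx, hy⟩), walk_splice_add]
      · rw [Set.indicator_of_notMem hy,
          Set.indicator_of_notMem fun h => hy ((splice_mem_firstMaxSet i j x y).1 h).2]
    · rw [Set.indicator_of_notMem hx]
      symm
      refine (lintegral_congr fun y => ?_).trans lintegral_zero
      exact Set.indicator_of_notMem (fun h => hx ((splice_mem_firstMaxSet i j x y).1 h).1) _
  · exact (Measurable.indicator (by fun_prop) (measurableSet_firstMaxSet _ _))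
  · exact Measurable.lintegral_prod_right' (f := fun p : ℝ × ℝ => f (p.1 + p.2)) (by fun_prop)

/-- The walk decomposed at the first time of its maximum. -/
lemma sum_recordLaw_conv_nonposLaw (n : ℕ) :
    ∑ p ∈ Finset.HasAntidiagonal.antidiagonal n, recordLaw μ p.1 ∗ nonposLaw μ p.2 = walkLaw μ n := by
  refine Measure.ext_of_lintegral _ fun f hf => ?_
  rw [lintegral_finsetSum_measure, lintegral_walkLaw μ n hf]
  have : ∀ p ∈ Finset.HasAntidiagonal.antidiagonal n, ∫⁻ t, f t ∂(recordLaw μ p.1 ∗ nonposLaw μ p.2) =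
      ∫⁻ z, (firstMaxSet p.1 n).indicator (fun z => f (walk z n)) z ∂seqLaw μ := by
    rintro ⟨i, j⟩ hp
    obtain rfl := Finset.HasAntidiagonal.mem_antidiagonal.1 hp
    exact lintegral_recordLaw_conv_nonposLaw μ i j hf
  rw [Finset.sum_congr rfl this, ← lintegral_finsetSum]
  · refine lintegral_congr fun z => ?_
    -- Every path has exactly one first maximiser up to n, so a single summand survives.
    obtain ⟨i, hi, hz⟩ := exists_mem_firstMaxSet z n
    rw [Finset.sum_eq_single (i, n - i)]
    · exact Set.indicator_of_mem hz _
    · rintro ⟨k, l⟩ hkl hne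
      refine Set.indicator_of_notMem (fun hk => hne ?_) _
      have hkl' := Finset.HasAntidiagonal.mem_antidiagonal.1 hkl
      simp only at hkl'
      obtain rfl := eq_of_mem_firstMaxSet (by omega) hi hk hz
      simp only [Prod.mk.injEq, true_and]; omega
    · intro h; exact absurd (Finset.HasAntidiagonal.mem_antidiagonal.2 (by simp only; omega)) h
  · intro p _
    exact Measurable.indicator (by fun_prop) (measurableSet_firstMaxSet _ _)

end RandomWalk

/-! ### Spitzer's identity in the convolution semiring of finite measures -/

namespace RandomWalk

open scoped ENNReal

/-- Finite measures on the line form a commutative semiring under convolution. -/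
noncomputable instance : CommSemiring (FiniteMeasure ℝ) where
  mul ν ρ := ⟨(ν : Measure ℝ) ∗ (ρ : Measure ℝ), inferInstance⟩
  one := ⟨Measure.dirac 0, inferInstance⟩
  left_distrib ν ρ σ := Subtype.ext (Measure.conv_add (ν : Measure ℝ) ρ σ)
  right_distrib ν ρ σ := Subtype.ext (Measure.add_conv (ν : Measure ℝ) ρ σ)
  zero_mul ν := Subtype.ext (Measure.zero_conv (ν : Measure ℝ))
  mul_zero ν := Subtype.ext (Measure.conv_zero (ν : Measure ℝ))
  mul_assoc ν ρ σ := Subtype.ext (Measure.conv_assoc (ν : Measure ℝ) ρ σ)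
  one_mul ν := Subtype.ext (Measure.dirac_zero_conv (ν : Measure ℝ))
  mul_one ν := Subtype.ext (Measure.conv_dirac_zero (ν : Measure ℝ))
  mul_comm ν ρ := Subtype.ext (Measure.conv_comm (ν : Measure ℝ) ρ)

/-- Measures cannot be subtracted; finiteness gives cancellation, which suffices for comparing
coefficients. -/
instance : IsCancelAdd (FiniteMeasure ℝ) :=
  have : IsLeftCancelAdd (FiniteMeasure ℝ) := ⟨fun ν ρ σ h => by
    refine FiniteMeasure.eq_of_forall_apply_eq _ _ fun s _ => ?_
    have := congrArg (fun τ : FiniteMeasure ℝ => τ s) h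
    simp only [FiniteMeasure.coeFn_add, Pi.add_apply] at this
    exact add_left_cancel this⟩
  AddCommMagma.IsLeftCancelAdd.toIsCancelAdd (FiniteMeasure ℝ)

/-- The part of a finite measure carried by the positive half-line. -/
noncomputable def posPart : FiniteMeasure ℝ →+ FiniteMeasure ℝ where
  toFun ν := ν.restrict (Set.Ioi 0)
  map_zero' := Subtype.ext (Measure.restrict_zero _)
  map_add' ν ρ := Subtype.ext (Measure.restrict_add (ν : Measure ℝ) ρ _)

open PowerSeries in
/-- Uniqueness of the logarithmic derivative in a factorization whose factors are separated by
an additive projection. -/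
lemma coeff_derivative_eq_of_projection {R : Type*} [CommSemiring R] [IsCancelAdd R]
    (π : R →+ R) (G K A B : PowerSeries R)
    (h : derivative R (G * K) = (A + B) * (G * K))
    (hG : coeff 0 G = 1) (hK : coeff 0 K = 1)
    (h1 : ∀ n, π (coeff n (derivative R G)) = coeff n (derivative R G))
    (h2 : ∀ n, π (coeff n (A * G)) = coeff n (A * G))
    (h3 : ∀ n, π (coeff n (derivative R K)) = 0) (h4 : ∀ n, π (coeff n (B * K)) = 0) (n : ℕ) :
    coeff n (derivative R G) = coeff n (A * G) ∧ coeff n (derivative R K) = coeff n (B * K) := by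
  induction n using Nat.strong_induction_on with
  | _ n ih =>
    have key : derivative R G * K + G * derivative R K = A * G * K + G * (B * K) := by
      have h' := h
      rw [Derivation.leibniz, smul_eq_mul, smul_eq_mul] at h'
      calc derivative R G * K + G * derivative R K
          = G * derivative R K + K * derivative R G := by ring
        _ = _ := by rw [h']; ring
    have hn := congrArg (coeff n) key
    rw [map_add, map_add, coeff_mul, coeff_mul, coeff_mul, coeff_mul] at hn
    have e1 : ∀ f : PowerSeries R,
        ∑ p ∈ Finset.HasAntidiagonal.antidiagonal n, coeff p.1 f * coeff p.2 K =
          coeff n f + ∑ p ∈ (Finset.HasAntidiagonal.antidiagonal n).erase (n, 0),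
            coeff p.1 f * coeff p.2 K := by
      intro f
      rw [← Finset.add_sum_erase _ _ (show (n, 0) ∈ Finset.HasAntidiagonal.antidiagonal n by simp),
        hK, mul_one]
    have e2 : ∀ f : PowerSeries R,
        ∑ p ∈ Finset.HasAntidiagonal.antidiagonal n, coeff p.1 G * coeff p.2 f =
          coeff n f + ∑ p ∈ (Finset.HasAntidiagonal.antidiagonal n).erase (0, n),
            coeff p.1 G * coeff p.2 f := by
      intro f
      rw [← Finset.add_sum_erase _ _ (show (0, n) ∈ Finset.HasAntidiagonal.antidiagonal n by simp),
        hG, one_mul]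
    rw [e1, e1, e2, e2] at hn
    have i1 : ∑ p ∈ (Finset.HasAntidiagonal.antidiagonal n).erase (n, 0),
        coeff p.1 (derivative R G) * coeff p.2 K =
        ∑ p ∈ (Finset.HasAntidiagonal.antidiagonal n).erase (n, 0),
          coeff p.1 (A * G) * coeff p.2 K := by
      refine Finset.sum_congr rfl ?_
      rintro ⟨i, j⟩ hp
      obtain ⟨hne, hp⟩ := Finset.mem_erase.1 hp
      have hij := Finset.HasAntidiagonal.mem_antidiagonal.1 hp
      simp only at hij
      rw [(ih i (lt_of_le_of_ne (by omega) (by rintro rfl; apply hne; simp; omega))).1]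
    have i2 : ∑ p ∈ (Finset.HasAntidiagonal.antidiagonal n).erase (0, n),
        coeff p.1 G * coeff p.2 (derivative R K) =
        ∑ p ∈ (Finset.HasAntidiagonal.antidiagonal n).erase (0, n),
          coeff p.1 G * coeff p.2 (B * K) := by
      refine Finset.sum_congr rfl ?_
      rintro ⟨i, j⟩ hp
      obtain ⟨hne, hp⟩ := Finset.mem_erase.1 hp
      have hij := Finset.HasAntidiagonal.mem_antidiagonal.1 hp
      simp only at hij
      rw [(ih j (lt_of_le_of_ne (by omega) (by rintro rfl; apply hne; simp; omega))).2]
    rw [i1, i2, add_add_add_comm, add_add_add_comm (coeff n (A * G))] at hn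
    -- By induction the lower-order terms on both sides agree. What is left is G'_n + K'_n = (AG)_n
    -- + (BK)_n; the projection fixes the G-terms and annihilates the K-terms, and a second
    -- cancellation gives the other identity.
    have hn' := add_right_cancel hn
    have hπ := congrArg π hn'
    rw [map_add, map_add, h1, h2, h3, h4, add_zero, add_zero] at hπ
    refine ⟨hπ, ?_⟩
    rw [hπ] at hn'
    exact add_left_cancel hn'

variable (μ : Measure ℝ) [IsProbabilityMeasure μ]

omit [IsProbabilityMeasure μ] in
lemma recordLaw_succ_ae_pos (n : ℕ) : ∀ᵐ t ∂recordLaw μ (n + 1), 0 < t := by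
  have hm : MeasurableSet {t : ℝ | 0 < t} := measurableSet_Ioi
  rw [recordLaw, ae_map_iff (by fun_prop) hm, ae_restrict_iff' (measurableSet_recordSet _)]
  refine ae_of_all _ fun x hx => ?_
  simpa using hx 0 (Nat.succ_pos n)

lemma recordLaw_ae_nonneg (n : ℕ) : ∀ᵐ t ∂recordLaw μ n, 0 ≤ t := by
  rcases n with _ | n
  · rw [recordLaw_zero]
    simp [ae_dirac_eq]
  · exact (recordLaw_succ_ae_pos μ n).mono fun t ht => ht.le

omit [IsProbabilityMeasure μ] in
lemma nonposLaw_ae_nonpos (n : ℕ) : ∀ᵐ t ∂nonposLaw μ n, t ≤ 0 := by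
  have hm : MeasurableSet {t : ℝ | t ≤ 0} := measurableSet_Iic
  rw [nonposLaw, ae_map_iff (by fun_prop) hm, ae_restrict_iff' (measurableSet_nonposSet _)]
  exact ae_of_all _ fun x hx => hx n le_rfl

lemma ae_conv {ν ρ : Measure ℝ} [SFinite ν] [SFinite ρ] {p q r : ℝ → Prop}
    (hν : ∀ᵐ a ∂ν, p a) (hρ : ∀ᵐ b ∂ρ, q b) (hr : MeasurableSet {t | r t})
    (h : ∀ a b, p a → q b → r (a + b)) : ∀ᵐ t ∂(ν ∗ ρ), r t := by
  rw [Measure.conv, ae_map_iff (by fun_prop) hr]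
  filter_upwards [Measure.quasiMeasurePreserving_fst.ae hν,
    Measure.quasiMeasurePreserving_snd.ae hρ] with x h1 h2 using h _ _ h1 h2

lemma posPart_eq_self {ν : FiniteMeasure ℝ} (h : ∀ᵐ t ∂(ν : Measure ℝ), 0 < t) :
    posPart ν = ν :=
  Subtype.ext (Measure.restrict_eq_self_of_ae_mem h)

lemma posPart_eq_zero {ν : FiniteMeasure ℝ} (h : ∀ᵐ t ∂(ν : Measure ℝ), t ≤ 0) :
    posPart ν = 0 := by
  refine Subtype.ext (Measure.restrict_eq_zero.2 ?_)
  rw [ae_iff] at h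
  simpa [Set.Ioi] using h

open PowerSeries in
/-- The measure form of Spitzer's identity. -/
theorem sum_posPart_walkLaw_conv_recordLaw (n : ℕ) :
    ∑ p ∈ Finset.HasAntidiagonal.antidiagonal n,
      (walkLaw μ (p.1 + 1)).restrict (Set.Ioi 0) ∗ recordLaw μ p.2 =
        (n + 1) • recordLaw μ (n + 1) := by
  let w : ℕ → FiniteMeasure ℝ := fun n => ⟨walkLaw μ n, inferInstance⟩
  let g : ℕ → FiniteMeasure ℝ := fun n => ⟨recordLaw μ n, inferInstance⟩
  let k : ℕ → FiniteMeasure ℝ := fun n => ⟨nonposLaw μ n, inferInstance⟩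
  let wp : ℕ → FiniteMeasure ℝ := fun n => posPart (w n)
  let wn : ℕ → FiniteMeasure ℝ := fun n => (w n).restrict (Set.Iic 0)
  have hwsum : ∀ n, wp n + wn n = w n := fun n => Subtype.ext (by
    have h := Measure.restrict_add_restrict_compl (μ := walkLaw μ n) (measurableSet_Ioi (a := (0 : ℝ)))
    rw [Set.compl_Ioi] at h
    exact h)
  have hww : ∀ i j, w i * w j = w (i + j) := fun i j => Subtype.ext (walkLaw_conv μ i j)
  have hgk : PowerSeries.mk g * PowerSeries.mk k = PowerSeries.mk w := by
    ext1 n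
    rw [coeff_mul]
    simp only [coeff_mk]
    refine Subtype.ext ?_
    rw [FiniteMeasure.val_eq_toMeasure, FiniteMeasure.toMeasure_sum]
    exact sum_recordLaw_conv_nonposLaw μ n
  have hwp : ∀ n, ∀ᵐ t ∂(wp n : Measure ℝ), 0 < t := fun n =>
    ae_restrict_mem (μ := walkLaw μ n) measurableSet_Ioi
  have hwn : ∀ n, ∀ᵐ t ∂(wn n : Measure ℝ), t ≤ 0 := fun n =>
    ae_restrict_mem (μ := walkLaw μ n) measurableSet_Iic
  have main := coeff_derivative_eq_of_projection posPart (PowerSeries.mk g) (PowerSeries.mk k)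
    (PowerSeries.mk fun n => wp (n + 1)) (PowerSeries.mk fun n => wn (n + 1)) ?_ ?_ ?_ ?_ ?_ ?_ ?_ n
  · have h := congrArg (fun ν : FiniteMeasure ℝ => (ν : Measure ℝ)) main.1
    simp only [coeff_mul, coeff_derivative, coeff_mk] at h
    rw [FiniteMeasure.toMeasure_sum] at h
    refine Eq.trans (b := ((g (n + 1) * (n + 1 : FiniteMeasure ℝ) : FiniteMeasure ℝ) : Measure ℝ))
      h.symm ?_
    rw [mul_comm, ← Nat.cast_succ, ← nsmul_eq_mul, FiniteMeasure.toMeasure_smul]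
    rfl
  -- Each of the n + 1 products w_{i+1} * w_j with i + j = n equals w_{n+1}, and their sum is the
  -- n-th coefficient of the derivative of ∑ w_n z^n.
  · rw [hgk]
    ext1 n
    simp only [coeff_mul, coeff_derivative, coeff_mk, map_add, hwsum, hww]
    rw [Finset.sum_congr rfl (g := fun _ => w (n + 1)), Finset.sum_const,
      Finset.Nat.card_antidiagonal, nsmul_eq_mul, mul_comm, Nat.cast_succ]
    intro p hp
    rw [← Finset.HasAntidiagonal.mem_antidiagonal.1 hp]
    congr 1; ring
  · simp only [coeff_mk]
    exact Subtype.ext (recordLaw_zero μ)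
  · simp only [coeff_mk]
    exact Subtype.ext (nonposLaw_zero μ)
  · intro n
    rw [coeff_derivative, coeff_mk, mul_comm, ← Nat.cast_succ, ← nsmul_eq_mul, map_nsmul,
      posPart_eq_self (ν := g (n + 1)) (recordLaw_succ_ae_pos μ n)]
  · intro n
    rw [coeff_mul, map_sum]
    refine Finset.sum_congr rfl fun p _ => ?_
    simp only [coeff_mk]
    exact posPart_eq_self (ae_conv (hwp _) (recordLaw_ae_nonneg μ _) measurableSet_Ioi
      fun a b ha hb => add_pos_of_pos_of_nonneg ha hb)
  · intro n
    rw [coeff_derivative, coeff_mk, mul_comm, ← Nat.cast_succ, ← nsmul_eq_mul, map_nsmul,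
      posPart_eq_zero (ν := k (n + 1)) (nonposLaw_ae_nonpos μ _), smul_zero]
  · intro n
    rw [coeff_mul, map_sum]
    refine Finset.sum_eq_zero fun p _ => ?_
    simp only [coeff_mk]
    exact posPart_eq_zero (ae_conv (hwn _) (nonposLaw_ae_nonpos μ _) measurableSet_Iic
      fun a b ha hb => add_nonpos ha hb)

/-! ### Exponential transforms of the factorization -/

/-- The exponential transform of a measure on the line. -/
noncomputable def expTransform (ν : Measure ℝ) (v : ℝ) : ℝ≥0∞ :=
  ∫⁻ t, ENNReal.ofReal (Real.exp (v * t)) ∂ν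

lemma expTransform_conv (ν ρ : Measure ℝ) [SFinite ν] [SFinite ρ] (v : ℝ) :
    expTransform (ν ∗ ρ) v = expTransform ν v * expTransform ρ v := by
  unfold expTransform
  rw [Measure.lintegral_conv (by fun_prop), ← lintegral_mul_const _ (by fun_prop)]
  refine lintegral_congr fun a => ?_
  rw [← lintegral_const_mul _ (by fun_prop)]
  refine lintegral_congr fun b => ?_
  rw [mul_add, Real.exp_add, ENNReal.ofReal_mul (Real.exp_pos _).le]

lemma expTransform_sum {ι : Type*} (s : Finset ι) (ν : ι → Measure ℝ) (v : ℝ) :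
    expTransform (∑ i ∈ s, ν i) v = ∑ i ∈ s, expTransform (ν i) v :=
  lintegral_finsetSum_measure _ _ _

lemma expTransform_dirac_zero (v : ℝ) : expTransform (Measure.dirac 0) v = 1 := by
  simp [expTransform]

/-- Spitzer's identity in terms of transforms. -/
theorem sum_expTransform_recordLaw (v : ℝ) (n : ℕ) :
    ∑ p ∈ Finset.HasAntidiagonal.antidiagonal n,
      expTransform ((walkLaw μ (p.1 + 1)).restrict (Set.Ioi 0)) v *
        expTransform (recordLaw μ p.2) v = (n + 1) * expTransform (recordLaw μ (n + 1)) v := by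
  have h := congrArg (fun ν => expTransform ν v) (sum_posPart_walkLaw_conv_recordLaw μ n)
  simp only [expTransform_sum, expTransform_conv] at h
  rw [h, ← Nat.cast_smul_eq_nsmul ℝ≥0∞, expTransform, lintegral_smul_measure]
  simp [expTransform]

lemma expTransform_walkLaw (v : ℝ) (n : ℕ) :
    expTransform (walkLaw μ n) v = expTransform μ v ^ n := by
  induction n with
  | zero => rw [walkLaw_zero, expTransform_dirac_zero, pow_zero]
  | succ n ih =>
    have : walkLaw μ 1 = μ := by simp only [walkLaw, walk_one]; exact seqLaw_map_eval μ 0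
    rw [← walkLaw_conv, expTransform_conv, ih, this, pow_succ]

/-- The Wiener--Hopf factorization in terms of transforms. -/
theorem sum_expTransform_recordLaw_mul_nonposLaw (v : ℝ) (n : ℕ) :
    ∑ p ∈ Finset.HasAntidiagonal.antidiagonal n,
      expTransform (recordLaw μ p.1) v * expTransform (nonposLaw μ p.2) v =
        expTransform μ v ^ n := by
  rw [← expTransform_walkLaw, ← sum_recordLaw_conv_nonposLaw, expTransform_sum]
  simp only [expTransform_conv]

end RandomWalk

/-! ### Generating functions: exponential form and finiteness -/

namespace RandomWalk

open scoped ENNReal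

lemma summable_succ_mul_pow {c : ℕ → ℝ} (hc : Summable fun n => ‖c n‖) {r : ℝ} (hr0 : 0 ≤ r)
    (hr : r < 1) : Summable fun n : ℕ => ‖((n : ℝ) + 1) * c (n + 1)‖ * r ^ n := by
  have h1 : Summable fun n : ℕ => ((n : ℝ) + 1) * r ^ n := by
    have h2 := summable_pow_mul_geometric_of_norm_lt_one 1
      (show ‖r‖ < 1 by rwa [Real.norm_of_nonneg hr0])
    have h3 := summable_geometric_of_lt_one hr0 hr
    refine (h2.add h3).congr fun n => ?_
    ring
  refine Summable.of_nonneg_of_le (fun n => by positivity) (fun n => ?_)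
    (h1.mul_left (∑' n, ‖c n‖))
  rw [norm_mul, Real.norm_of_nonneg (by positivity : (0 : ℝ) ≤ (n : ℝ) + 1)]
  have := hc.le_tsum (n + 1) fun _ _ => norm_nonneg _
  calc ((n : ℝ) + 1) * ‖c (n + 1)‖ * r ^ n = ‖c (n + 1)‖ * (((n : ℝ) + 1) * r ^ n) := by ring
    _ ≤ _ := by gcongr

lemma hasDerivAt_tsum_mul_pow {c : ℕ → ℝ} (hc : Summable fun n => ‖c n‖) {t : ℝ} (ht : |t| < 1) :
    HasDerivAt (fun z => ∑' n, c n * z ^ n) (∑' n : ℕ, ((n : ℝ) + 1) * c (n + 1) * t ^ n) t := by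
  obtain ⟨r, htr, hr⟩ := exists_between ht
  have hr0 : 0 ≤ r := (abs_nonneg t).trans htr.le
  have hterm : ∀ n, ∀ y ∈ Set.Ioo (-r) r, HasDerivAt (fun z => c (n + 1) * z ^ (n + 1))
      (((n : ℝ) + 1) * c (n + 1) * y ^ n) y := by
    intro n y _
    refine ((hasDerivAt_pow (n + 1) y).const_mul (c (n + 1))).congr_deriv ?_
    rw [Nat.add_sub_cancel]
    push_cast
    ring
  have key := hasDerivAt_tsum_of_isPreconnected (summable_succ_mul_pow hc hr0 hr) isOpen_Ioo
    isPreconnected_Ioo hterm (fun n y hy => ?_) (y₀ := 0) (y := t) ?_ ?_ (abs_lt.1 htr)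
  · have h0 := key.const_add (c 0)
    refine h0.congr_of_eventuallyEq ?_
    have hopen : Set.Ioo (-1 : ℝ) 1 ∈ 𝓝 t := isOpen_Ioo.mem_nhds (abs_lt.1 ht)
    filter_upwards [hopen] with z hz
    have hs : Summable fun n => c n * z ^ n := by
      refine Summable.of_norm_bounded hc fun n => ?_
      rw [norm_mul, norm_pow]
      exact mul_le_of_le_one_right (norm_nonneg _)
        (pow_le_one₀ (norm_nonneg _) (abs_lt.2 hz).le)
    rw [hs.tsum_eq_zero_add]
    simp
  · rw [norm_mul, norm_pow]
    gcongr
    exact (abs_lt.2 hy).le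
  · exact ⟨neg_lt_zero.2 ((abs_nonneg t).trans_lt htr), (abs_nonneg t).trans_lt htr⟩
  · simp

/-- Absolute summability of the coefficients includes the endpoint 1, where the differential
equation on [0, 1) is finally evaluated. -/
lemma continuousOn_tsum_mul_pow {c : ℕ → ℝ} (hc : Summable fun n => ‖c n‖) :
    ContinuousOn (fun z : ℝ => ∑' n, c n * z ^ n) (Set.Icc 0 1) := by
  refine continuousOn_tsum (fun n => by fun_prop) hc fun n x hx => ?_
  rw [norm_mul, norm_pow]
  exact mul_le_of_le_one_right (norm_nonneg _)
    (pow_le_one₀ (norm_nonneg _) (by rw [Real.norm_of_nonneg hx.1]; exact hx.2))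

/-- A nonnegative summable sequence with prescribed logarithmic derivative of its generating
function. -/
lemma exp_tsum_eq_tsum_of_recursion {g b : ℕ → ℝ} (hg0 : g 0 = 1) (hg : ∀ n, 0 ≤ g n)
    (hb : ∀ n, 0 ≤ b n)
    (hrec : ∀ n : ℕ, ∑ p ∈ Finset.HasAntidiagonal.antidiagonal n, b p.1 * g p.2 =
      ((n : ℝ) + 1) * g (n + 1))
    (hs : Summable g) :
    Summable (fun n : ℕ => b n / ((n : ℝ) + 1)) ∧
      Real.exp (∑' n : ℕ, b n / ((n : ℝ) + 1)) = ∑' n, g n := by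
  -- The recursion contains the nonnegative term b n * g 0 with g 0 = 1, so summability passes from
  -- g to the exponent.
  have hle : ∀ n : ℕ, b n / ((n : ℝ) + 1) ≤ g (n + 1) := by
    intro n
    rw [div_le_iff₀ (by positivity), mul_comm, ← hrec n]
    have := Finset.single_le_sum (f := fun p : ℕ × ℕ => b p.1 * g p.2)
      (fun p _ => mul_nonneg (hb _) (hg _))
      (show (n, 0) ∈ Finset.HasAntidiagonal.antidiagonal n by simp)
    simpa [hg0] using this
  have hsum : Summable (fun n : ℕ => b n / ((n : ℝ) + 1)) :=
    Summable.of_nonneg_of_le (fun n => div_nonneg (hb n) (by positivity)) hle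
      ((summable_nat_add_iff 1).2 hs)
  refine ⟨hsum, ?_⟩
  have hgn : Summable fun n => ‖g n‖ := hs.norm
  let c : ℕ → ℝ := fun n => Nat.casesOn n 0 fun m => b m / ((m : ℝ) + 1)
  have hc0 : c 0 = 0 := rfl
  have hcs : ∀ m, c (m + 1) = b m / ((m : ℝ) + 1) := fun _ => rfl
  have hcsum : Summable c := (summable_nat_add_iff 1).1 hsum
  have hcn : Summable fun n => ‖c n‖ := hcsum.norm
  have hcb : ∀ n : ℕ, ((n : ℝ) + 1) * c (n + 1) = b n := fun n => by
    rw [hcs]; field_simp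
  set G : ℝ → ℝ := fun z => ∑' n, g n * z ^ n with hG
  set Λ : ℝ → ℝ := fun z => ∑' n, c n * z ^ n with hΛ
  -- The recursion says G' = Λ' G, so G exp(-Λ) is constant; its value at 0 is 1 and its value at 1
  -- is the claim.
  have hcont : ContinuousOn (fun z => G z * Real.exp (-Λ z)) (Set.Icc 0 1) :=
    (continuousOn_tsum_mul_pow hgn).mul (continuousOn_tsum_mul_pow hcn).neg.rexp
  have hderiv : ∀ t ∈ Set.Ico (0 : ℝ) 1,
      HasDerivWithinAt (fun z => G z * Real.exp (-Λ z)) 0 (Set.Ici t) t := by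
    intro t ht
    have habs : |t| < 1 := by rw [abs_of_nonneg ht.1]; exact ht.2
    have h1 := hasDerivAt_tsum_mul_pow hgn habs
    have h2 := hasDerivAt_tsum_mul_pow hcn habs
    have hprod : ∑' n : ℕ, ((n : ℝ) + 1) * g (n + 1) * t ^ n =
        (∑' n : ℕ, ((n : ℝ) + 1) * c (n + 1) * t ^ n) * G t := by
      have hbn : Summable fun n : ℕ => ‖b n * t ^ n‖ := by
        have := summable_succ_mul_pow hcn ht.1 ht.2
        refine this.congr fun n => ?_
        rw [hcb, norm_mul, norm_pow, Real.norm_of_nonneg ht.1]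
      have hgt : Summable fun n : ℕ => ‖g n * t ^ n‖ := by
        refine Summable.of_nonneg_of_le (fun n => norm_nonneg _) (fun n => ?_) hgn
        rw [norm_mul, norm_pow]
        exact mul_le_of_le_one_right (norm_nonneg _) (pow_le_one₀ (norm_nonneg _) habs.le)
      simp only [hcb]
      rw [hG, tsum_mul_tsum_eq_tsum_sum_antidiagonal_of_summable_norm hbn hgt]
      refine tsum_congr fun n => ?_
      rw [← hrec, Finset.sum_mul]
      refine Finset.sum_congr rfl fun p hp => ?_
      rw [← Finset.HasAntidiagonal.mem_antidiagonal.1 hp, pow_add]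
      ring
    refine ((h1.mul h2.neg.exp).congr_deriv ?_).hasDerivWithinAt
    rw [hprod]
    simp only [hG, Pi.neg_apply]
    ring
  have hconst := constant_of_has_deriv_right_zero hcont hderiv 1 ⟨zero_le_one, le_rfl⟩
  have hG0 : G 0 = 1 := by
    simp only [hG]
    rw [tsum_eq_single 0 (fun n hn => by simp [hn])]; simp [hg0]
  have hΛ0 : Λ 0 = 0 := by
    simp only [hΛ]
    rw [tsum_eq_single 0 (fun n hn => by simp [hn])]; simp [hc0]
  have hG1 : G 1 = ∑' n, g n := by simp [hG]
  have hΛ1 : Λ 1 = ∑' n : ℕ, b n / ((n : ℝ) + 1) := by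
    simp only [hΛ, one_pow, mul_one]
    rw [hcsum.tsum_eq_zero_add, hc0, zero_add]
  simp only [hG0, hΛ0, hG1, hΛ1, neg_zero, Real.exp_zero, mul_one] at hconst
  rw [Real.exp_neg] at hconst
  exact ((mul_inv_eq_one₀ (Real.exp_ne_zero _)).1 hconst).symm

lemma ENNReal_tsum_mul_tsum (f g : ℕ → ℝ≥0∞) :
    (∑' n, f n) * ∑' n, g n =
      ∑' n, ∑ p ∈ Finset.HasAntidiagonal.antidiagonal n, f p.1 * g p.2 := by
  have h1 : ∀ n, ∑ p ∈ Finset.HasAntidiagonal.antidiagonal n, f p.1 * g p.2 =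
      ∑' p : Finset.HasAntidiagonal.antidiagonal n, f (p : ℕ × ℕ).1 * g (p : ℕ × ℕ).2 := by
    intro n
    rw [← Finset.tsum_subtype]
  simp_rw [h1]
  rw [← ENNReal.tsum_sigma' (f := fun q : (Σ n : ℕ, Finset.HasAntidiagonal.antidiagonal n) => f (q.2 : ℕ × ℕ).1 * g (q.2 : ℕ × ℕ).2)]
  rw [← Finset.HasAntidiagonal.sigmaAntidiagonalEquivProd.symm.tsum_eq, ENNReal.tsum_prod']
  simp only [Finset.HasAntidiagonal.sigmaAntidiagonalEquivProd_symm_apply_snd_coe, ENNReal.tsum_mul_left, ENNReal.tsum_mul_right]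

variable (μ : Measure ℝ) [IsProbabilityMeasure μ]

/-- The generating function of the record transforms. -/
noncomputable def recordGen (s v : ℝ) : ℝ≥0∞ :=
  ∑' n, ENNReal.ofReal s ^ n * expTransform (recordLaw μ n) v

/-- The Wiener–Hopf product of `recordGen` and the nonpositive factor K is the geometric series in s
E e^{v X}. For v ≥ 0 the transforms in K are at most 1, so 1 ≤ K ≤ 1/(1 - s), with s replaced by 0
if negative, and K does not affect finiteness. -/
lemma recordGen_lt_top_iff {s v : ℝ} (hs1 : s < 1) (hv : 0 ≤ v) :
    recordGen μ s v < ⊤ ↔ ENNReal.ofReal s * expTransform μ v < 1 := by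
  have hprod : recordGen μ s v * ∑' n, ENNReal.ofReal s ^ n * expTransform (nonposLaw μ n) v =
      ∑' n, (ENNReal.ofReal s * expTransform μ v) ^ n := by
    rw [recordGen, ENNReal_tsum_mul_tsum]
    refine tsum_congr fun n => ?_
    rw [mul_pow, ← sum_expTransform_recordLaw_mul_nonposLaw, Finset.mul_sum]
    refine Finset.sum_congr rfl fun p hp => ?_
    rw [← Finset.HasAntidiagonal.mem_antidiagonal.1 hp, pow_add]
    ring
  set K := ∑' n, ENNReal.ofReal s ^ n * expTransform (nonposLaw μ n) v
  have hK1 : 1 ≤ K := by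
    refine le_trans (le_of_eq ?_) (ENNReal.le_tsum 0)
    rw [nonposLaw_zero, expTransform_dirac_zero, pow_zero, mul_one]
  have hKtop : K < ⊤ := by
    refine lt_of_le_of_lt (b := ∑' n, ENNReal.ofReal s ^ n) (ENNReal.tsum_le_tsum fun n => ?_) ?_
    · refine mul_le_of_le_one_right zero_le ?_
      calc expTransform (nonposLaw μ n) v ≤ ∫⁻ _, 1 ∂nonposLaw μ n := by
            refine lintegral_mono_ae ?_
            filter_upwards [nonposLaw_ae_nonpos μ n] with t ht
            rw [ENNReal.ofReal_le_one, Real.exp_le_one_iff]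
            exact mul_nonpos_of_nonneg_of_nonpos hv ht
        _ ≤ 1 := by
            rw [lintegral_one, nonposLaw, Measure.map_apply (by fun_prop) .univ]
            exact (Measure.restrict_apply_le _ _).trans prob_le_one
    · rw [ENNReal.tsum_geometric, ENNReal.inv_lt_top, tsub_pos_iff_lt]
      exact ENNReal.ofReal_lt_one.2 hs1
  have hgeo : (∑' n, (ENNReal.ofReal s * expTransform μ v) ^ n) < ⊤ ↔
      ENNReal.ofReal s * expTransform μ v < 1 := by
    rw [ENNReal.tsum_geometric, ENNReal.inv_lt_top, tsub_pos_iff_lt]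
  rw [← hgeo, ← hprod]
  constructor
  · exact fun h => ENNReal.mul_lt_top h hKtop
  · intro h
    exact lt_of_le_of_lt (le_mul_of_one_le_right zero_le hK1) h

end RandomWalk

/-! ### The one-sided maximum for an exponential right tail -/

namespace RandomWalk

open scoped ENNReal

/-- A nonatomic step law with exponential right tail of rate `δ` and Cramér exponent `γ`. -/
structure IsStepLaw (μ : Measure ℝ) (γ δ b : ℝ) : Prop where
  delta_pos : 0 < δ
  b_pos : 0 < b
  gamma_pos : 0 < γ
  right_tail : μ.restrict (Set.Ioi 0) =
    (volume.restrict (Set.Ioi 0)).withDensity fun x => ENNReal.ofReal (b * δ * Real.exp (-(δ * x)))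
  cramer : expTransform μ γ = 1
  noAtoms : ∀ c, μ {c} = 0

variable {μ : Measure ℝ} {γ δ b : ℝ}

lemma IsStepLaw.restrict_Ioi (h : IsStepLaw μ γ δ b) {y : ℝ} (hy : 0 ≤ y) :
    μ.restrict (Set.Ioi y) = (volume.restrict (Set.Ioi y)).withDensity
      fun x => ENNReal.ofReal (b * δ * Real.exp (-(δ * x))) := by
  have h1 := congrArg (fun ν : Measure ℝ => ν.restrict (Set.Ioi y)) h.right_tail
  simp only [restrict_withDensity measurableSet_Ioi,
    Measure.restrict_restrict measurableSet_Ioi] at h1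
  rwa [Set.Ioi_inter_Ioi, max_eq_left hy] at h1

lemma IsStepLaw.setLIntegral_exp (h : IsStepLaw μ γ δ b) {y θ : ℝ} (hy : 0 ≤ y) :
    ∫⁻ t in Set.Ioi y, ENNReal.ofReal (Real.exp (θ * t)) ∂μ =
      ∫⁻ t in Set.Ioi y, ENNReal.ofReal (b * δ * Real.exp ((θ - δ) * t)) := by
  rw [h.restrict_Ioi hy, lintegral_withDensity_eq_lintegral_mul _ (by fun_prop) (by fun_prop)]
  refine lintegral_congr fun t => ?_
  have := h.delta_pos; have := h.b_pos
  rw [Pi.mul_apply, ← ENNReal.ofReal_mul (by positivity), mul_assoc, ← Real.exp_add]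
  ring_nf

lemma IsStepLaw.setLIntegral_exp_of_lt (h : IsStepLaw μ γ δ b) {y θ : ℝ} (hy : 0 ≤ y)
    (hθ : θ < δ) :
    ∫⁻ t in Set.Ioi y, ENNReal.ofReal (Real.exp (θ * t)) ∂μ =
      ENNReal.ofReal (b * (δ / (δ - θ)) * Real.exp ((θ - δ) * y)) := by
  have hb := h.b_pos; have hd := h.delta_pos
  rw [h.setLIntegral_exp hy, ← ofReal_integral_eq_lintegral_ofReal]
  · rw [integral_const_mul, integral_exp_mul_Ioi (by linarith)]
    congr 1
    have : θ - δ ≠ 0 := by linarith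
    have : δ - θ ≠ 0 := by linarith
    have h2 : θ - δ = -(δ - θ) := by ring
    rw [h2]
    field_simp
  · exact (integrableOn_exp_mul_Ioi (by linarith) y).const_mul _
  · exact ae_of_all _ fun t => by positivity

/-- If γ ≥ δ, the integral of e^{γ t} over the exponential tail already diverges, against E e^{γ X}
= 1. -/
lemma IsStepLaw.gamma_lt_delta (h : IsStepLaw μ γ δ b) : γ < δ := by
  by_contra hcon
  have hle : δ ≤ γ := not_lt.1 hcon
  have h1 : ∫⁻ t in Set.Ioi 0, ENNReal.ofReal (Real.exp (γ * t)) ∂μ ≤ 1 := by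
    rw [← h.cramer]
    exact setLIntegral_le_lintegral _ _
  rw [h.setLIntegral_exp le_rfl] at h1
  have h2 : ∫⁻ _ in Set.Ioi (0 : ℝ), ENNReal.ofReal (b * δ) ≤ 1 := by
    refine le_trans (setLIntegral_mono' measurableSet_Ioi fun t ht => ?_) h1
    have := h.delta_pos; have := h.b_pos
    refine ENNReal.ofReal_le_ofReal (le_mul_of_one_le_right (by positivity) ?_)
    exact Real.one_le_exp (mul_nonneg (by linarith) (le_of_lt ht))
  rw [setLIntegral_const, Real.volume_Ioi, ENNReal.mul_top] at h2
  · exact absurd h2 (by simp)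
  · simpa using mul_pos h.b_pos h.delta_pos

lemma IsStepLaw.measure_Ioi (h : IsStepLaw μ γ δ b) {y : ℝ} (hy : 0 ≤ y) :
    μ (Set.Ioi y) = ENNReal.ofReal (b * Real.exp (-δ * y)) := by
  have := h.setLIntegral_exp_of_lt hy (θ := 0) h.delta_pos
  simpa [div_self h.delta_pos.ne'] using this

variable [IsProbabilityMeasure μ]

/-- Strict convexity made explicit: (1 + e^{γ t})/2 - e^{γ t/2} = (e^{γ t/2} - 1)²/2, which has
positive integral because the step is positive with positive probability. This replaces any
statement about the mean of the step as the source of negative drift. -/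
lemma IsStepLaw.expTransform_half_lt_one (h : IsStepLaw μ γ δ b) :
    expTransform μ (γ / 2) < 1 := by
  have hg := h.gamma_pos
  have hsum : expTransform μ (γ / 2) +
      ∫⁻ t, ENNReal.ofReal ((Real.exp (γ / 2 * t) - 1) ^ 2 / 2) ∂μ = 1 := by
    rw [expTransform, ← lintegral_add_left (by fun_prop)]
    have : ∀ t : ℝ, ENNReal.ofReal (Real.exp (γ / 2 * t)) +
        ENNReal.ofReal ((Real.exp (γ / 2 * t) - 1) ^ 2 / 2) =
        ENNReal.ofReal (1 / 2) + ENNReal.ofReal (1 / 2) * ENNReal.ofReal (Real.exp (γ * t)) := by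
      intro t
      rw [← ENNReal.ofReal_add (by positivity) (by positivity),
        ← ENNReal.ofReal_mul (by positivity), ← ENNReal.ofReal_add (by positivity) (by positivity)]
      congr 1
      have : Real.exp (γ * t) = Real.exp (γ / 2 * t) ^ 2 := by
        rw [← Real.exp_nat_mul]; congr 1; push_cast; ring
      rw [this]; ring
    simp_rw [this]
    rw [lintegral_add_left (by fun_prop), lintegral_const_mul _ (by fun_prop)]
    have hc := h.cramer
    rw [expTransform] at hc
    rw [hc, lintegral_const, measure_univ, mul_one,
      ← ENNReal.ofReal_add (by norm_num) (by norm_num)]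
    norm_num
  have hpos : 0 < ∫⁻ t, ENNReal.ofReal ((Real.exp (γ / 2 * t) - 1) ^ 2 / 2) ∂μ := by
    rw [lintegral_pos_iff_support (by fun_prop)]
    refine lt_of_lt_of_le ?_ (measure_mono (s := Set.Ioi 0) fun t ht => ?_)
    · rw [h.measure_Ioi le_rfl]
      simpa using h.b_pos
    · have h1 : 1 < Real.exp (γ / 2 * t) := Real.one_lt_exp_iff.2 (mul_pos (by linarith) ht)
      have h2 : 0 < (Real.exp (γ / 2 * t) - 1) ^ 2 / 2 := by
        have := sub_pos.2 h1; positivity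
      simpa [Function.mem_support] using h2
  refine lt_of_le_of_ne (hsum ▸ le_self_add) fun h1 => ?_
  rw [h1] at hsum
  have : (1 : ℝ≥0∞) + ∫⁻ t, ENNReal.ofReal ((Real.exp (γ / 2 * t) - 1) ^ 2 / 2) ∂μ = 1 + 0 := by
    rw [hsum, add_zero]
  exact hpos.ne' ((ENNReal.add_right_inj ENNReal.one_ne_top).1 this)

/-- The walk stays below `x` up to time `n`. -/
def belowSet (x : ℝ) (n : ℕ) : Set (ℕ → ℝ) := {z | ∀ j ≤ n, walk z j ≤ x}

lemma measurableSet_belowSet (x : ℝ) (n : ℕ) : MeasurableSet (belowSet x n) := by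
  simp only [belowSet, Set.ofPred_forall]
  refine MeasurableSet.iInter fun j => MeasurableSet.iInter fun _ => ?_
  exact measurableSet_le (by fun_prop) (by fun_prop)

lemma belowSet_succ (x : ℝ) (n : ℕ) :
    belowSet x (n + 1) = belowSet x n ∩ {z | walk z (n + 1) ≤ x} := by
  ext z
  simp only [belowSet, Set.mem_ofPred_eq, Set.mem_inter_iff, Nat.le_succ_iff]
  constructor
  · exact fun h => ⟨fun j hj => h j (Or.inl hj), h _ (Or.inr rfl)⟩
  · rintro ⟨h1, h2⟩ j (hj | rfl)
    exacts [h1 j hj, h2]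

variable (μ) in
-- The event depends on the first n steps only, so the next step can be integrated out on its own.
lemma setLIntegral_belowSet_step (x : ℝ) (n : ℕ) {f : ℝ → ℝ → ℝ≥0∞}
    (hf : Measurable fun p : ℝ × ℝ => f p.1 p.2) :
    ∫⁻ z in belowSet x n, f (walk z n) (z n) ∂seqLaw μ =
      ∫⁻ z in belowSet x n, ∫⁻ t, f (walk z n) t ∂μ ∂seqLaw μ := by
  have hm := measurableSet_belowSet x n
  rw [← lintegral_indicator hm, ← lintegral_indicator hm, lintegral_splice μ n]
  · refine lintegral_congr fun z => ?_
    have hz : ∀ y, splice n z y ∈ belowSet x n ↔ z ∈ belowSet x n := fun y =>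
      forall₂_congr fun j hj => by rw [walk_splice_of_le hj]
    by_cases hzm : z ∈ belowSet x n
    · rw [Set.indicator_of_mem hzm, ← lintegral_eval μ 0 (by fun_prop)]
      refine lintegral_congr fun y => ?_
      rw [Set.indicator_of_mem ((hz y).2 hzm), walk_splice_of_le le_rfl]
      simp [splice]
    · rw [Set.indicator_of_notMem hzm]
      refine (lintegral_congr fun y => ?_).trans lintegral_zero
      exact Set.indicator_of_notMem (fun h => hzm ((hz y).1 h)) _
  · exact Measurable.indicator (by fun_prop) hm

/-- The law of the all-time maximum of the walk. -/
theorem IsStepLaw.measure_forall_walk_le (h : IsStepLaw μ γ δ b) {x : ℝ} (hx : 0 ≤ x) :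
    seqLaw μ {z | ∀ j, walk z j ≤ x} =
      ENNReal.ofReal (1 - (1 - γ / δ) * Real.exp (-γ * x)) := by
  have hγ := h.gamma_pos
  have hδ := h.delta_pos
  have hb := h.b_pos
  have hγδ := h.gamma_lt_delta
  have hsub : 0 < δ - γ := by linarith
  -- K is the mean of e^{γ S} at first passage above x: the level x plus an independent overshoot of
  -- rate δ. Below, e n is the part of E e^{γ S_n} not yet stopped, and q n is the probability of
  -- first passage at time n + 1.
  set K : ℝ := δ / (δ - γ) * Real.exp (γ * x) with hK
  have hKpos : 0 < K := by positivity
  set P : ℕ → ℝ≥0∞ := fun n => seqLaw μ (belowSet x n) with hP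
  set e : ℕ → ℝ≥0∞ := fun n => ∫⁻ z in belowSet x n, ENNReal.ofReal (Real.exp (γ * walk z n)) ∂seqLaw μ
    with he
  set q : ℕ → ℝ≥0∞ := fun n => seqLaw μ (belowSet x n ∩ {z | x < walk z (n + 1)}) with hq
  have hm1 : ∀ n, MeasurableSet {z : ℕ → ℝ | walk z (n + 1) ≤ x} := fun n =>
    measurableSet_le (by fun_prop) (by fun_prop)
  have hm2 : ∀ n, MeasurableSet {z : ℕ → ℝ | x < walk z (n + 1)} := fun n =>
    measurableSet_lt (by fun_prop) (by fun_prop)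
  have hcompl : ∀ n, {z : ℕ → ℝ | walk z (n + 1) ≤ x}ᶜ = {z | x < walk z (n + 1)} := fun n => by
    ext z; simp
  have hPq : ∀ n, P n = P (n + 1) + q n := by
    intro n
    have := measure_inter_add_sdiff (μ := seqLaw μ) (belowSet x n) (hm1 n)
    rw [← belowSet_succ, Set.sdiff_eq, hcompl] at this
    exact this.symm
  have hind : Measurable fun p : ℝ × ℝ => (Set.Ioi (x - p.1)).indicator (1 : ℝ → ℝ≥0∞) p.2 := by
    have : (fun p : ℝ × ℝ => (Set.Ioi (x - p.1)).indicator (1 : ℝ → ℝ≥0∞) p.2) =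
        {p : ℝ × ℝ | x - p.1 < p.2}.indicator 1 := by
      ext p; simp [Set.indicator]
    rw [this]
    exact measurable_one.indicator (measurableSet_lt (by fun_prop) (by fun_prop))
  have hover : ∀ n, ∫⁻ z in belowSet x n ∩ {z | x < walk z (n + 1)},
      ENNReal.ofReal (Real.exp (γ * walk z (n + 1))) ∂seqLaw μ = ENNReal.ofReal K * q n := by
    intro n
    have e1 : ∀ g : (ℕ → ℝ) → ℝ≥0∞, ∫⁻ z in belowSet x n ∩ {z | x < walk z (n + 1)}, g z ∂seqLaw μ =
        ∫⁻ z in belowSet x n, (Set.Ioi (x - walk z n)).indicator (1 : ℝ → ℝ≥0∞) (z n) * g z ∂seqLaw μ := by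
      intro g
      rw [Set.inter_comm, ← Measure.restrict_restrict (hm2 n), ← lintegral_indicator (hm2 n)]
      refine lintegral_congr fun z => ?_
      have : (x < walk z (n + 1)) ↔ x - walk z n < z n := by
        rw [walk_succ]; constructor <;> intro <;> linarith
      simp [Set.indicator, this]
    have e2 : q n = ∫⁻ z in belowSet x n ∩ {z | x < walk z (n + 1)}, 1 ∂seqLaw μ := by
      rw [setLIntegral_one]
    rw [e2, e1, e1]
    simp only [walk_succ, mul_one]
    rw [setLIntegral_belowSet_step μ x n (f := fun s t => (Set.Ioi (x - s)).indicator (1 : ℝ → ℝ≥0∞) t *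
        ENNReal.ofReal (Real.exp (γ * (s + t)))) (by fun_prop),
      setLIntegral_belowSet_step μ x n (f := fun s t => (Set.Ioi (x - s)).indicator (1 : ℝ → ℝ≥0∞) t) hind,
      ← lintegral_const_mul' _ _ ENNReal.ofReal_ne_top]
    -- With y = x - S_n ≥ 0, both integrals over steps larger than y are explicit, and their
    -- quotient K no longer depends on S_n: this is memorylessness.
    refine setLIntegral_congr_fun (measurableSet_belowSet x n) fun z hz => ?_
    have hzn : 0 ≤ x - walk z n := sub_nonneg.2 (hz n le_rfl)
    rw [lintegral_indicator_one measurableSet_Ioi, h.measure_Ioi hzn]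
    have e3 : ∀ t, (Set.Ioi (x - walk z n)).indicator (1 : ℝ → ℝ≥0∞) t *
        ENNReal.ofReal (Real.exp (γ * (walk z n + t))) =
        (Set.Ioi (x - walk z n)).indicator (fun t => ENNReal.ofReal (Real.exp (γ * walk z n)) *
          ENNReal.ofReal (Real.exp (γ * t))) t := by
      intro t
      by_cases ht : t ∈ Set.Ioi (x - walk z n)
      · rw [Set.indicator_of_mem ht, Set.indicator_of_mem ht, Pi.one_apply, one_mul, mul_add,
          Real.exp_add, ENNReal.ofReal_mul (Real.exp_pos _).le]
      · rw [Set.indicator_of_notMem ht, Set.indicator_of_notMem ht, zero_mul]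
    simp_rw [e3]
    rw [lintegral_indicator measurableSet_Ioi, lintegral_const_mul _ (by fun_prop),
      h.setLIntegral_exp_of_lt hzn hγδ, ← ENNReal.ofReal_mul (by positivity),
      ← ENNReal.ofReal_mul (by positivity), hK]
    congr 1
    have e4 : Real.exp (γ * walk z n) * Real.exp ((γ - δ) * (x - walk z n)) =
        Real.exp (γ * x) * Real.exp (-δ * (x - walk z n)) := by
      rw [← Real.exp_add, ← Real.exp_add]; congr 1; ring
    linear_combination (b * (δ / (δ - γ))) * e4
  have hestep : ∀ n, e n = e (n + 1) + ENNReal.ofReal K * q n := by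
    intro n
    have e1 : e n = ∫⁻ z in belowSet x n, ENNReal.ofReal (Real.exp (γ * walk z (n + 1))) ∂seqLaw μ := by
      simp only [walk_succ]
      rw [setLIntegral_belowSet_step μ x n
        (f := fun s t => ENNReal.ofReal (Real.exp (γ * (s + t)))) (by fun_prop)]
      refine lintegral_congr fun z => ?_
      have : ∀ t, ENNReal.ofReal (Real.exp (γ * (walk z n + t))) =
          ENNReal.ofReal (Real.exp (γ * walk z n)) * ENNReal.ofReal (Real.exp (γ * t)) := by
        intro t
        rw [mul_add, Real.exp_add, ENNReal.ofReal_mul (Real.exp_pos _).le]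
      simp_rw [this]
      rw [lintegral_const_mul _ (by fun_prop)]
      have hc := h.cramer
      rw [expTransform] at hc
      rw [hc, mul_one]
    rw [e1, ← hover n, he]
    simp only
    rw [belowSet_succ, ← lintegral_inter_add_sdiff _ _ (hm1 n), Set.sdiff_eq, hcompl]
  -- Optional stopping at time n, that is 1 = e n + K (1 - P n), written without subtraction.
  have hbal : ∀ n, 1 + ENNReal.ofReal K * P n = e n + ENNReal.ofReal K := by
    intro n
    induction n with
    | zero =>
      have h0 : belowSet x 0 = Set.univ := by ext z; simp [belowSet, hx]
      simp [hP, he, h0]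
    | succ n ih =>
      rw [hPq n, hestep n, mul_add, ← add_assoc, add_right_comm] at ih
      have hqfin : ENNReal.ofReal K * q n ≠ ⊤ :=
        ENNReal.mul_ne_top ENNReal.ofReal_ne_top (measure_ne_top _ _)
      rw [add_right_comm (e (n + 1)), add_right_comm] at ih
      refine (ENNReal.add_left_inj hqfin).1 ?_
      rw [← ih]
  -- On S_n ≤ x one has e^{γ S_n} ≤ e^{γ x/2} e^{γ S_n/2}, and the mean of the last factor decays
  -- geometrically.
  have he0 : Tendsto e atTop (𝓝 0) := by
    have hr := h.expTransform_half_lt_one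
    have hlim : Tendsto (fun n => ENNReal.ofReal (Real.exp (γ / 2 * x)) * expTransform μ (γ / 2) ^ n)
        atTop (𝓝 0) := by
      have := ENNReal.Tendsto.const_mul (ENNReal.tendsto_pow_atTop_nhds_zero_of_lt_one hr)
        (Or.inr (ENNReal.ofReal_ne_top (r := Real.exp (γ / 2 * x))))
      rwa [mul_zero] at this
    refine tendsto_of_tendsto_of_tendsto_of_le_of_le tendsto_const_nhds hlim
      (fun _ => zero_le) fun n => ?_
    calc e n ≤ ∫⁻ z in belowSet x n, ENNReal.ofReal (Real.exp (γ / 2 * x)) *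
          ENNReal.ofReal (Real.exp (γ / 2 * walk z n)) ∂seqLaw μ := by
          refine setLIntegral_mono (by fun_prop) fun z hz => ?_
          rw [← ENNReal.ofReal_mul (Real.exp_pos _).le, ← Real.exp_add]
          refine ENNReal.ofReal_le_ofReal (Real.exp_le_exp.2 ?_)
          have := hz n le_rfl
          nlinarith
      _ ≤ ∫⁻ z, ENNReal.ofReal (Real.exp (γ / 2 * x)) *
          ENNReal.ofReal (Real.exp (γ / 2 * walk z n)) ∂seqLaw μ := setLIntegral_le_lintegral _ _
      _ = _ := by
          rw [lintegral_const_mul _ (by fun_prop), ← expTransform_walkLaw, expTransform,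
            lintegral_walkLaw μ n (by fun_prop)]
  have hPlim : Tendsto P atTop (𝓝 (seqLaw μ {z | ∀ j, walk z j ≤ x})) := by
    have hset : {z : ℕ → ℝ | ∀ j, walk z j ≤ x} = ⋂ n, belowSet x n := by
      ext z
      simp only [belowSet, Set.mem_ofPred_eq, Set.mem_iInter]
      exact ⟨fun hz _ j _ => hz j, fun hz j => hz j j le_rfl⟩
    rw [hset]
    refine tendsto_measure_iInter_atTop
      (fun n => (measurableSet_belowSet x n).nullMeasurableSet) ?_ ⟨0, measure_ne_top _ _⟩
    exact fun n m hnm z hz j hj => hz j (hj.trans hnm)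
  have hfinal : 1 + ENNReal.ofReal K * seqLaw μ {z | ∀ j, walk z j ≤ x} = ENNReal.ofReal K := by
    have h1 : Tendsto (fun n => 1 + ENNReal.ofReal K * P n) atTop
        (𝓝 (1 + ENNReal.ofReal K * seqLaw μ {z | ∀ j, walk z j ≤ x})) :=
      tendsto_const_nhds.add (ENNReal.Tendsto.const_mul hPlim (Or.inr ENNReal.ofReal_ne_top))
    have h2 : Tendsto (fun n => e n + ENNReal.ofReal K) atTop (𝓝 (0 + ENNReal.ofReal K)) :=
      he0.add tendsto_const_nhds
    rw [zero_add] at h2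
    simp_rw [hbal] at h1
    exact tendsto_nhds_unique h1 h2
  have hreal := congrArg ENNReal.toReal hfinal
  rw [ENNReal.toReal_add ENNReal.one_ne_top
    (ENNReal.mul_ne_top ENNReal.ofReal_ne_top (measure_ne_top _ _)), ENNReal.toReal_mul,
    ENNReal.toReal_ofReal hKpos.le, ENNReal.toReal_one] at hreal
  rw [← ENNReal.ofReal_toReal (measure_ne_top (seqLaw μ) _)]
  congr 1
  have hKinv : K * ((1 - γ / δ) * Real.exp (-γ * x)) = 1 := by
    have : Real.exp (γ * x) * Real.exp (-γ * x) = 1 := by rw [← Real.exp_add]; simp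
    rw [hK]
    calc δ / (δ - γ) * Real.exp (γ * x) * ((1 - γ / δ) * Real.exp (-γ * x))
        = (δ / (δ - γ) * (1 - γ / δ)) * (Real.exp (γ * x) * Real.exp (-γ * x)) := by ring
      _ = 1 := by rw [this]; field_simp
  have hmul : K * (seqLaw μ {z | ∀ j, walk z j ≤ x}).toReal =
      K * (1 - (1 - γ / δ) * Real.exp (-γ * x)) := by
    rw [mul_sub, hKinv]; linarith
  exact mul_left_cancel₀ hKpos.ne' hmul

lemma IsStepLaw.measure_nonposAlways (h : IsStepLaw μ γ δ b) :
    seqLaw μ nonposAlways = ENNReal.ofReal (γ / δ) := by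
  have := h.measure_forall_walk_le le_rfl
  rw [mul_zero, Real.exp_zero] at this
  rw [nonposAlways, this]
  congr 1; ring

/-- Splicing at n separates the record event from the event that the later walk stays nonpositive;
the latter has probability γ/δ. -/
lemma IsStepLaw.setLIntegral_firstArgmax (h : IsStepLaw μ γ δ b) (n : ℕ) {f : ℝ → ℝ≥0∞}
    (hf : Measurable f) :
    ∫⁻ z in firstArgmax n, f (walk z n) ∂seqLaw μ =
      ENNReal.ofReal (γ / δ) * ∫⁻ t, f t ∂recordLaw μ n := by
  rw [← lintegral_indicator (measurableSet_firstArgmax n), lintegral_splice μ n,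
    lintegral_recordLaw μ n hf, ← lintegral_const_mul' _ _ ENNReal.ofReal_ne_top]
  · refine lintegral_congr fun x => ?_
    by_cases hx : x ∈ recordSet n
    · rw [Set.indicator_of_mem hx, ← h.measure_nonposAlways, mul_comm,
        ← lintegral_indicator_one measurableSet_nonposAlways,
        ← lintegral_const_mul _ (measurable_one.indicator measurableSet_nonposAlways)]
      refine lintegral_congr fun y => ?_
      by_cases hy : y ∈ nonposAlways
      · rw [Set.indicator_of_mem ((splice_mem_firstArgmax n x y).2 ⟨hx, hy⟩),
          Set.indicator_of_mem hy, walk_splice_of_le le_rfl, Pi.one_apply, mul_one]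
      · rw [Set.indicator_of_notMem hy, mul_zero,
          Set.indicator_of_notMem fun h => hy ((splice_mem_firstArgmax n x y).1 h).2]
    · rw [Set.indicator_of_notMem hx, mul_zero]
      refine (lintegral_congr fun y => ?_).trans lintegral_zero
      exact Set.indicator_of_notMem (fun h => hx ((splice_mem_firstArgmax n x y).1 h).1) _
  · exact Measurable.indicator (by fun_prop) (measurableSet_firstArgmax n)

/-- The sum over n of e^{γ S_n/2} has finite expectation, a geometric series, so its terms tend to 0
almost surely. -/
lemma IsStepLaw.ae_tendsto_atBot (h : IsStepLaw μ γ δ b) :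
    ∀ᵐ z ∂seqLaw μ, Tendsto (walk z) atTop atBot := by
  have hfin : ∫⁻ z, ∑' n, ENNReal.ofReal (Real.exp (γ / 2 * walk z n)) ∂seqLaw μ ≠ ⊤ := by
    rw [lintegral_tsum fun n => by fun_prop]
    have : ∀ n, ∫⁻ z, ENNReal.ofReal (Real.exp (γ / 2 * walk z n)) ∂seqLaw μ =
        expTransform μ (γ / 2) ^ n := by
      intro n
      rw [← expTransform_walkLaw, expTransform, lintegral_walkLaw μ n (by fun_prop)]
    simp_rw [this]
    rw [ENNReal.tsum_geometric]
    exact (ENNReal.inv_lt_top.2 (tsub_pos_iff_lt.2 h.expTransform_half_lt_one)).ne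
  filter_upwards [ae_lt_top' (by fun_prop) hfin] with z hz
  have h0 := ENNReal.tendsto_atTop_zero_of_tsum_ne_top hz.ne
  have h1 : Tendsto (fun n => Real.exp (γ / 2 * walk z n)) atTop (𝓝 0) := by
    have := (ENNReal.tendsto_toReal ENNReal.zero_ne_top).comp h0
    simpa [Function.comp_def, ENNReal.toReal_ofReal (Real.exp_pos _).le] using this
  have h2 : Tendsto (fun n => γ / 2 * walk z n) atTop atBot := Real.tendsto_exp_comp_nhds_zero.1 h1
  exact (tendsto_const_mul_atBot_of_pos (half_pos h.gamma_pos)).1 h2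

/-- Once the later steps are fixed, the first step would have to equal a given number. -/
lemma IsStepLaw.walkLaw_singleton (h : IsStepLaw μ γ δ b) (n : ℕ) (c : ℝ) :
    seqLaw μ {z | walk z (n + 1) = c} = 0 := by
  have hm : MeasurableSet {z : ℕ → ℝ | walk z (n + 1) = c} :=
    measurableSet_eq_fun (by fun_prop) (by fun_prop)
  rw [← lintegral_indicator_one hm, lintegral_splice μ 1 (measurable_one.indicator hm),
    lintegral_lintegral_swap]
  · refine (lintegral_congr fun y => ?_).trans lintegral_zero
    have e : ∀ x : ℕ → ℝ, {z : ℕ → ℝ | walk z (n + 1) = c}.indicator (1 : (ℕ → ℝ) → ℝ≥0∞) (splice 1 x y) =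
        ({c - walk y n} : Set ℝ).indicator 1 (x 0) := by
      intro x
      have : walk (splice 1 x y) (n + 1) = c ↔ x 0 = c - walk y n := by
        rw [add_comm n 1, walk_splice_add, walk_one]
        constructor <;> intro <;> linarith
      simp [Set.indicator, this]
    simp_rw [e]
    rw [lintegral_eval μ 0 (f := ({c - walk y n} : Set ℝ).indicator 1)
      (measurable_one.indicator (measurableSet_singleton _)),
      lintegral_indicator_one (measurableSet_singleton _)]
    exact h.noAtoms _
  · exact ((measurable_one.indicator hm).comp (measurable_splice 1)).aemeasurable

lemma IsStepLaw.ae_injective (h : IsStepLaw μ γ δ b) :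
    ∀ᵐ z ∂seqLaw μ, Function.Injective (walk z) := by
  have hlt : ∀ n m : ℕ, ∀ᵐ z ∂seqLaw μ, walk z n ≠ walk z (n + (m + 1)) := by
    intro n m
    have hm : MeasurableSet {z : ℕ → ℝ | walk z n ≠ walk z (n + (m + 1))} :=
      (measurableSet_eq_fun (by fun_prop) (by fun_prop)).compl
    rw [← seqLaw_map_splice μ n, ae_map_iff (by fun_prop) hm]
    have hm0 : MeasurableSet {z : ℕ → ℝ | walk z (m + 1) ≠ 0} :=
      (measurableSet_eq_fun (by fun_prop) (by fun_prop)).compl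
    have h0 : ∀ᵐ y ∂seqLaw μ, walk y (m + 1) ≠ 0 := by
      rw [ae_iff]; simpa using h.walkLaw_singleton m 0
    filter_upwards [Measure.quasiMeasurePreserving_snd.ae h0] with p hp
    rw [walk_splice_add, walk_splice_of_le le_rfl]
    intro hcon
    exact hp (by linarith)
  have := ae_all_iff.2 fun n => ae_all_iff.2 fun m => hlt n m
  filter_upwards [this] with z hz n m hnm
  rcases lt_trichotomy n m with hl | hl | hl
  · obtain ⟨k, rfl⟩ := Nat.exists_eq_add_of_lt hl
    exact absurd hnm (hz n k)
  · exact hl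
  · obtain ⟨k, rfl⟩ := Nat.exists_eq_add_of_lt hl
    exact absurd hnm.symm (hz m k)

end RandomWalk

/-! ### The maximum of two independent walks and its transform -/

namespace RandomWalk

open scoped ENNReal

/-- The weight `sⁿ e^{u S_n}` of a pair of sequences when the first walk attains at time `n ≥ 1`
for the first time its maximum, and this maximum is at least that of the second walk. -/
noncomputable def sideWeight (s u : ℝ) (x y : ℕ → ℝ) : ℝ≥0∞ :=
  ∑' n : ℕ, {p : (ℕ → ℝ) × (ℕ → ℝ) | p.1 ∈ firstArgmax (n + 1) ∧
    ∀ m, walk p.2 m ≤ walk p.1 (n + 1)}.indicator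
      (fun p => ENNReal.ofReal s ^ (n + 1) * ENNReal.ofReal (Real.exp (u * walk p.1 (n + 1)))) (x, y)

/-- The weight `s^{|Z|} e^{u M}` of a pair of sequences, as a sum over the possible values
of `Z`. -/
noncomputable def pairWeight (s u : ℝ) (x y : ℕ → ℝ) : ℝ≥0∞ :=
  (nonposAlways ×ˢ nonposAlways).indicator 1 (x, y) + (sideWeight s u x y + sideWeight s u y x)

lemma pairWeight_comm (s u : ℝ) (x y : ℕ → ℝ) : pairWeight s u x y = pairWeight s u y x := by
  rw [pairWeight, pairWeight, add_comm (sideWeight s u x y)]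
  congr 1
  by_cases h : x ∈ nonposAlways ∧ y ∈ nonposAlways
  · rw [Set.indicator_of_mem (Set.mem_prod.2 h), Set.indicator_of_mem (Set.mem_prod.2 h.symm)]
    rfl
  · rw [Set.indicator_of_notMem fun hm => h (Set.mem_prod.1 hm),
      Set.indicator_of_notMem fun hm => h (Set.mem_prod.1 hm).symm]

/-- The regularity of a pair of walks that makes the two-sided maximum unique. -/
structure IsRegularPair (x y : ℕ → ℝ) : Prop where
  left_inj : Function.Injective (walk x)
  right_inj : Function.Injective (walk y)
  left_tendsto : Tendsto (walk x) atTop atBot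
  right_tendsto : Tendsto (walk y) atTop atBot
  ne : ∀ n m, walk x (n + 1) ≠ walk y (m + 1)

lemma IsRegularPair.symm {x y : ℕ → ℝ} (h : IsRegularPair x y) : IsRegularPair y x :=
  ⟨h.right_inj, h.left_inj, h.right_tendsto, h.left_tendsto, fun n m => (h.ne m n).symm⟩

lemma mem_firstArgmax_of_forall_le {x : ℕ → ℝ} (hx : Function.Injective (walk x)) {n : ℕ}
    (h : ∀ m, walk x m ≤ walk x n) : x ∈ firstArgmax n :=
  ⟨fun k hk => lt_of_le_of_ne (h k) fun he => hk.ne (hx he), fun k _ => h k⟩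

lemma le_of_mem_firstArgmax {x : ℕ → ℝ} {n : ℕ} (h : x ∈ firstArgmax n) (m : ℕ) :
    walk x m ≤ walk x n :=
  (lt_or_ge m n).elim (fun hm => (h.1 m hm).le) fun hm => h.2 m hm

lemma sideWeight_eq_zero {s u : ℝ} {x y : ℕ → ℝ}
    (h : ∀ n, x ∈ firstArgmax (n + 1) → ∃ m, walk x (n + 1) < walk y m) :
    sideWeight s u x y = 0 := by
  refine ENNReal.tsum_eq_zero.2 fun n => Set.indicator_of_notMem ?_ _
  rintro ⟨h1, h2⟩
  obtain ⟨m, hm⟩ := h n h1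
  exact absurd hm (not_lt.2 (h2 m))

/-- Without ties exactly one term of the sum defining `pairWeight` is nonzero, the one belonging to
the actual maximiser. Ties between the sides would make both side weights count. -/
lemma pairWeight_eq_of_forall_le {s u : ℝ} {x y : ℕ → ℝ} (h : IsRegularPair x y) {n : ℕ}
    (hx : ∀ m, walk x m ≤ walk x n) (hy : ∀ m, walk y m ≤ walk x n) :
    pairWeight s u x y = ENNReal.ofReal s ^ n * ENNReal.ofReal (Real.exp (u * walk x n)) := by
  rcases n with _ | n
  · rw [walk_zero] at hx hy
    have e : ∀ {x : ℕ → ℝ} (y : ℕ → ℝ), (∀ m, walk x m ≤ 0) → sideWeight s u x y = 0 := by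
      intro x y hx
      refine sideWeight_eq_zero fun n hn => ?_
      have := hn.1 0 (Nat.succ_pos n)
      rw [walk_zero] at this
      exact absurd (hx (n + 1)) (not_le.2 this)
    rw [pairWeight, e y hx, e x hy, Set.indicator_of_mem
      (show (x, y) ∈ nonposAlways ×ˢ nonposAlways from ⟨hx, hy⟩)]
    simp
  · have hpos : 0 < walk x (n + 1) := by
      refine lt_of_le_of_ne (by simpa using hx 0) fun he => ?_
      exact absurd (h.left_inj (a₁ := 0) (a₂ := n + 1) (by rw [← he, walk_zero])) (by simp)
    have h1 : sideWeight s u y x = 0 := by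
      refine sideWeight_eq_zero fun m _ => ⟨n + 1, ?_⟩
      exact lt_of_le_of_ne (hy _) (h.ne n m).symm
    have h2 : (nonposAlways ×ˢ nonposAlways).indicator (1 : (ℕ → ℝ) × (ℕ → ℝ) → ℝ≥0∞) (x, y) = 0 :=
      Set.indicator_of_notMem (fun hm => absurd (hm.1 (n + 1)) (not_le.2 hpos)) _
    rw [pairWeight, h1, h2, zero_add, add_zero, sideWeight, tsum_eq_single n]
    · exact Set.indicator_of_mem (s := {p : (ℕ → ℝ) × (ℕ → ℝ) | p.1 ∈ firstArgmax (n + 1) ∧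
        ∀ m, walk p.2 m ≤ walk p.1 (n + 1)})
        ⟨mem_firstArgmax_of_forall_le h.left_inj hx, hy⟩ _
    · intro m hmn
      refine Set.indicator_of_notMem (fun hm => hmn ?_) _
      have := h.left_inj (le_antisymm (hx _) (le_of_mem_firstArgmax hm.1 (n + 1)))
      omega

lemma exists_forall_le_of_tendsto_atBot {f : ℕ → ℝ} (h : Tendsto f atTop atBot) :
    ∃ n, ∀ m, f m ≤ f n := by
  obtain ⟨N, hN⟩ := eventually_atTop.1 (h.eventually_le_atBot (f 0))
  obtain ⟨n, _, hn⟩ := Finset.exists_max_image (Finset.range (N + 1)) f ⟨0, by simp⟩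
  refine ⟨n, fun m => ?_⟩
  rcases le_or_gt N m with hm | hm
  · exact (hN m hm).trans (hn 0 (by simp))
  · exact hn m (by simp; omega)

/-- The two-sided walk made of two one-sided walks. -/
def twoSided (x y : ℕ → ℝ) (k : ℤ) : ℝ := if 0 ≤ k then walk x k.natAbs else walk y k.natAbs

lemma twoSided_natCast (x y : ℕ → ℝ) (n : ℕ) : twoSided x y n = walk x n := by
  simp [twoSided]

lemma twoSided_neg_natCast (x y : ℕ → ℝ) (n : ℕ) : twoSided x y (-n) = walk y n := by
  rcases n with _ | n
  · simp [twoSided]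
  · have : ¬ (0 : ℤ) ≤ -((n + 1 : ℕ) : ℤ) := by omega
    rw [twoSided, if_neg this, Int.natAbs_neg, Int.natAbs_natCast]

lemma forall_twoSided {x y : ℕ → ℝ} {p : ℝ → Prop} :
    (∀ j, p (twoSided x y j)) ↔ (∀ m, p (walk x m)) ∧ ∀ m, p (walk y m) := by
  refine ⟨fun h => ⟨fun m => twoSided_natCast x y m ▸ h m,
    fun m => twoSided_neg_natCast x y m ▸ h (-m)⟩, fun h j => ?_⟩
  unfold twoSided
  split_ifs
  exacts [h.1 _, h.2 _]

lemma IsRegularPair.twoSided_injective {x y : ℕ → ℝ} (h : IsRegularPair x y) :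
    Function.Injective (twoSided x y) := by
  have key : ∀ {x y : ℕ → ℝ}, IsRegularPair x y → ∀ n m : ℕ, walk x n = walk y (m + 1) → False := by
    intro x y h n m he
    rcases n with _ | n
    · rw [walk_zero, ← walk_zero y] at he
      exact absurd (h.right_inj he) (by simp)
    · exact h.ne n m he
  intro i j hij
  obtain ⟨n, rfl | rfl⟩ := i.eq_nat_or_neg <;> obtain ⟨m, rfl | rfl⟩ := j.eq_nat_or_neg
  · rw [twoSided_natCast, twoSided_natCast] at hij
    rw [h.left_inj hij]
  · rw [twoSided_natCast, twoSided_neg_natCast] at hij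
    rcases m with _ | m
    · rw [walk_zero, ← walk_zero x] at hij
      rw [h.left_inj hij]; simp
    · exact (key h _ _ hij).elim
  · rw [twoSided_natCast, twoSided_neg_natCast] at hij
    rcases n with _ | n
    · rw [walk_zero, ← walk_zero x] at hij
      rw [← h.left_inj hij]; simp
    · exact (key h _ _ hij.symm).elim
  · rw [twoSided_neg_natCast, twoSided_neg_natCast] at hij
    rw [h.right_inj hij]

lemma IsRegularPair.existsUnique_max {x y : ℕ → ℝ} (h : IsRegularPair x y) :
    ∃! k, ∀ j, twoSided x y j ≤ twoSided x y k := by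
  refine existsUnique_of_exists_of_unique ?_ fun i j hi hj =>
    h.twoSided_injective (le_antisymm (hj i) (hi j))
  obtain ⟨n, hn⟩ := exists_forall_le_of_tendsto_atBot h.left_tendsto
  obtain ⟨m, hm⟩ := exists_forall_le_of_tendsto_atBot h.right_tendsto
  rcases le_total (walk x n) (walk y m) with hle | hle
  · refine ⟨-m, ?_⟩
    rw [twoSided_neg_natCast]
    exact forall_twoSided (p := (· ≤ walk y m)).2 ⟨fun k => (hn k).trans hle, hm⟩
  · refine ⟨n, ?_⟩
    rw [twoSided_natCast]
    exact forall_twoSided (p := (· ≤ walk x n)).2 ⟨hn, fun k => (hm k).trans hle⟩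

lemma IsRegularPair.pairWeight_eq {s u : ℝ} {x y : ℕ → ℝ} (h : IsRegularPair x y) {k : ℤ}
    (hk : ∀ j, twoSided x y j ≤ twoSided x y k) :
    pairWeight s u x y =
      ENNReal.ofReal s ^ k.natAbs * ENNReal.ofReal (Real.exp (u * twoSided x y k)) := by
  obtain ⟨n, rfl | rfl⟩ := k.eq_nat_or_neg
  · rw [twoSided_natCast] at hk ⊢
    obtain ⟨h1, h2⟩ := forall_twoSided (p := (· ≤ walk x n)).1 hk
    rw [Int.natAbs_natCast]
    exact pairWeight_eq_of_forall_le h h1 h2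
  · rw [twoSided_neg_natCast] at hk ⊢
    obtain ⟨h1, h2⟩ := forall_twoSided (p := (· ≤ walk y n)).1 hk
    rw [Int.natAbs_neg, Int.natAbs_natCast, pairWeight_comm]
    exact pairWeight_eq_of_forall_le h.symm h2 h1

lemma measurableSet_sideSet (n : ℕ) : MeasurableSet {p : (ℕ → ℝ) × (ℕ → ℝ) |
    p.1 ∈ firstArgmax (n + 1) ∧ ∀ m, walk p.2 m ≤ walk p.1 (n + 1)} := by
  refine MeasurableSet.inter (measurable_fst (measurableSet_firstArgmax (n + 1))) ?_
  exact MeasurableSet.congr (MeasurableSet.iInter fun m => measurableSet_le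
    (f := fun p : (ℕ → ℝ) × (ℕ → ℝ) => walk p.2 m) (g := fun p => walk p.1 (n + 1))
    (by fun_prop) (by fun_prop)) (by ext p; exact Set.mem_iInter)

lemma measurable_sideWeight (s u : ℝ) :
    Measurable fun p : (ℕ → ℝ) × (ℕ → ℝ) => sideWeight s u p.1 p.2 := by
  unfold sideWeight
  exact Measurable.tsum fun n =>
    Measurable.indicator (by fun_prop) (measurableSet_sideSet n)

lemma measurable_pairWeight (s u : ℝ) :
    Measurable fun p : (ℕ → ℝ) × (ℕ → ℝ) => pairWeight s u p.1 p.2 := by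
  unfold pairWeight
  refine Measurable.add ?_ ((measurable_sideWeight s u).add
    ((measurable_sideWeight s u).comp measurable_swap))
  exact measurable_one.indicator (measurableSet_nonposAlways.prod measurableSet_nonposAlways)

section Pair

variable {μ ν : Measure ℝ} [IsProbabilityMeasure μ] [IsProbabilityMeasure ν]
  {γ δ b γ' δ' b' : ℝ}

lemma IsStepLaw.ae_isRegularPair (h : IsStepLaw μ γ δ b) (h' : IsStepLaw ν γ' δ' b') :
    ∀ᵐ p ∂(seqLaw μ).prod (seqLaw ν), IsRegularPair p.1 p.2 := by
  have hne : ∀ n m, ∀ᵐ p : (ℕ → ℝ) × (ℕ → ℝ) ∂(seqLaw μ).prod (seqLaw ν),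
      walk p.1 (n + 1) ≠ walk p.2 (m + 1) := by
    intro n m
    have hm : MeasurableSet {p : (ℕ → ℝ) × (ℕ → ℝ) | walk p.1 (n + 1) = walk p.2 (m + 1)} :=
      measurableSet_eq_fun (by fun_prop) (by fun_prop)
    rw [ae_iff]
    simp only [not_not]
    rw [Measure.measure_prod_null hm]
    refine ae_of_all _ fun x => ?_
    have := h'.walkLaw_singleton m (walk x (n + 1))
    simpa [Set.preimage, eq_comm] using this
  have hne' := ae_all_iff.2 fun n => ae_all_iff.2 fun m => hne n m
  filter_upwards [hne', Measure.quasiMeasurePreserving_fst.ae h.ae_injective,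
    Measure.quasiMeasurePreserving_snd.ae h'.ae_injective,
    Measure.quasiMeasurePreserving_fst.ae h.ae_tendsto_atBot,
    Measure.quasiMeasurePreserving_snd.ae h'.ae_tendsto_atBot] with p h1 h2 h3 h4 h5
  exact ⟨h2, h3, h4, h5, h1⟩

variable (μ) in
/-- The generating function of the record transforms without its constant term. -/
noncomputable def recordTail (s v : ℝ) : ℝ≥0∞ :=
  ∑' n : ℕ, ENNReal.ofReal s ^ (n + 1) * expTransform (recordLaw μ (n + 1)) v

variable (μ) in
lemma recordGen_eq_one_add (s v : ℝ) : recordGen μ s v = 1 + recordTail μ s v := by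
  rw [recordGen, tsum_eq_zero_add' ENNReal.summable, recordLaw_zero, expTransform_dirac_zero,
    pow_zero, mul_one, recordTail]

lemma lintegral_sideWeight (h : IsStepLaw μ γ δ b) (h' : IsStepLaw ν γ' δ' b') (s u : ℝ) :
    ∫⁻ p, sideWeight s u p.1 p.2 ∂(seqLaw μ).prod (seqLaw ν) =
      ∑' n : ℕ, ENNReal.ofReal s ^ (n + 1) * (ENNReal.ofReal (γ / δ) *
        ∫⁻ t, ENNReal.ofReal (Real.exp (u * t)) *
          ENNReal.ofReal (1 - (1 - γ' / δ') * Real.exp (-γ' * t)) ∂recordLaw μ (n + 1)) := by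
  unfold sideWeight
  rw [lintegral_tsum fun n =>
    (Measurable.indicator (by fun_prop) (measurableSet_sideSet n)).aemeasurable]
  refine tsum_congr fun n => ?_
  rw [lintegral_prod _
    (Measurable.indicator (by fun_prop) (measurableSet_sideSet n)).aemeasurable,
    ← h.setLIntegral_firstArgmax (n + 1) (by fun_prop), ← lintegral_const_mul _ (by fun_prop),
    ← lintegral_indicator (measurableSet_firstArgmax _)]
  refine lintegral_congr fun x => ?_
  by_cases hx : x ∈ firstArgmax (n + 1)
  · rw [Set.indicator_of_mem hx]
    have hx0 : 0 ≤ walk x (n + 1) := by simpa using (hx.1 0 (Nat.succ_pos n)).le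
    have hm : MeasurableSet {y : ℕ → ℝ | ∀ m, walk y m ≤ walk x (n + 1)} := by
      simp only [Set.ofPred_forall]
      exact MeasurableSet.iInter fun m => measurableSet_le (by fun_prop) (by fun_prop)
    rw [← h'.measure_forall_walk_le hx0, ← mul_assoc, ← lintegral_indicator_one hm,
      ← lintegral_const_mul _ (measurable_one.indicator hm)]
    refine lintegral_congr fun y => ?_
    by_cases hy : ∀ m, walk y m ≤ walk x (n + 1)
    · rw [Set.indicator_of_mem (s := {y : ℕ → ℝ | ∀ m, walk y m ≤ walk x (n + 1)}) hy,
        Set.indicator_of_mem (s := {p : (ℕ → ℝ) × (ℕ → ℝ) | p.1 ∈ firstArgmax (n + 1) ∧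
          ∀ m, walk p.2 m ≤ walk p.1 (n + 1)}) ⟨hx, hy⟩, Pi.one_apply, mul_one]
    · rw [Set.indicator_of_notMem (s := {y : ℕ → ℝ | ∀ m, walk y m ≤ walk x (n + 1)}) hy,
        Set.indicator_of_notMem fun hm => hy hm.2, mul_zero]
  · rw [Set.indicator_of_notMem hx]
    refine (lintegral_congr fun y => ?_).trans lintegral_zero
    exact Set.indicator_of_notMem (fun hm => hx hm.1) _

omit [IsProbabilityMeasure μ] in
lemma IsStepLaw.ratio_mem (h : IsStepLaw μ γ δ b) : 0 < γ / δ ∧ γ / δ < 1 :=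
  ⟨div_pos h.gamma_pos h.delta_pos, (div_lt_one h.delta_pos).2 h.gamma_lt_delta⟩

omit [IsProbabilityMeasure μ] in
lemma IsStepLaw.le_maxLaw (h : IsStepLaw μ γ δ b) {t : ℝ} (ht : 0 ≤ t) :
    γ / δ ≤ 1 - (1 - γ / δ) * Real.exp (-γ * t) := by
  have h1 : Real.exp (-γ * t) ≤ 1 :=
    Real.exp_le_one_iff.2 (by nlinarith [h.gamma_pos])
  nlinarith [h.ratio_mem.2]

/-- The maximum law of the other walk splits e^{u t} into the transforms at u and at u - γ'. The
negative term is moved to the left, so that the identity holds even when both sides are infinite. -/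
lemma lintegral_sideWeight_add (h : IsStepLaw μ γ δ b) (h' : IsStepLaw ν γ' δ' b') (s u : ℝ) :
    ∫⁻ p, sideWeight s u p.1 p.2 ∂(seqLaw μ).prod (seqLaw ν) +
      ENNReal.ofReal (γ / δ) * (ENNReal.ofReal (1 - γ' / δ') * recordTail μ s (u - γ')) =
        ENNReal.ofReal (γ / δ) * recordTail μ s u := by
  rw [lintegral_sideWeight h h', recordTail, recordTail, ← ENNReal.tsum_mul_left,
    ← ENNReal.tsum_mul_left, ← ENNReal.tsum_mul_left, ← ENNReal.tsum_add]
  refine tsum_congr fun n => ?_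
  have key : ∫⁻ t, ENNReal.ofReal (Real.exp (u * t)) *
          ENNReal.ofReal (1 - (1 - γ' / δ') * Real.exp (-γ' * t)) ∂recordLaw μ (n + 1) +
      ENNReal.ofReal (1 - γ' / δ') * expTransform (recordLaw μ (n + 1)) (u - γ') =
      expTransform (recordLaw μ (n + 1)) u := by
    rw [expTransform, expTransform, ← lintegral_const_mul _ (by fun_prop),
      ← lintegral_add_left (by fun_prop)]
    refine lintegral_congr_ae ?_
    filter_upwards [recordLaw_ae_nonneg μ (n + 1)] with t ht
    have h1 := h'.le_maxLaw ht
    have h2 := h'.ratio_mem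
    rw [← ENNReal.ofReal_mul (Real.exp_pos _).le, ← ENNReal.ofReal_mul (by linarith),
      ← ENNReal.ofReal_add (mul_nonneg (Real.exp_pos _).le (by linarith))
        (mul_nonneg (by linarith) (Real.exp_pos _).le)]
    congr 1
    have : Real.exp ((u - γ') * t) = Real.exp (u * t) * Real.exp (-γ' * t) := by
      rw [← Real.exp_add]; congr 1; ring
    rw [this]; ring
  rw [← key]; ring

/-- The other walk stays below any t ≥ 0 with probability at least γ'/δ' > 0. Hence the subtracted
transform cannot cancel an infinite one, which gives necessity in the finiteness criterion. -/
lemma le_lintegral_sideWeight (h : IsStepLaw μ γ δ b) (h' : IsStepLaw ν γ' δ' b') (s u : ℝ) :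
    ENNReal.ofReal (γ / δ) * ENNReal.ofReal (γ' / δ') * recordTail μ s u ≤
      ∫⁻ p, sideWeight s u p.1 p.2 ∂(seqLaw μ).prod (seqLaw ν) := by
  rw [lintegral_sideWeight h h', recordTail, ← ENNReal.tsum_mul_left]
  refine ENNReal.tsum_le_tsum fun n => ?_
  have key : ENNReal.ofReal (γ' / δ') * expTransform (recordLaw μ (n + 1)) u ≤
      ∫⁻ t, ENNReal.ofReal (Real.exp (u * t)) *
          ENNReal.ofReal (1 - (1 - γ' / δ') * Real.exp (-γ' * t)) ∂recordLaw μ (n + 1) := by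
    rw [expTransform, ← lintegral_const_mul _ (by fun_prop)]
    refine lintegral_mono_ae ?_
    filter_upwards [recordLaw_ae_nonneg μ (n + 1)] with t ht
    rw [mul_comm]
    gcongr
    exact h'.le_maxLaw ht
  calc _ = ENNReal.ofReal s ^ (n + 1) * (ENNReal.ofReal (γ / δ) *
      (ENNReal.ofReal (γ' / δ') * expTransform (recordLaw μ (n + 1)) u)) := by ring
    _ ≤ _ := by gcongr

lemma lintegral_sideWeight_lt_top_iff (h : IsStepLaw μ γ δ b) (h' : IsStepLaw ν γ' δ' b')
    (s u : ℝ) :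
    ∫⁻ p, sideWeight s u p.1 p.2 ∂(seqLaw μ).prod (seqLaw ν) < ⊤ ↔ recordGen μ s u < ⊤ := by
  rw [recordGen_eq_one_add, ENNReal.add_lt_top, and_iff_right ENNReal.one_lt_top]
  constructor
  · intro hfin
    have h1 := (le_lintegral_sideWeight h h' s u).trans_lt hfin
    by_contra htop
    rw [not_lt_top_iff.1 htop, ENNReal.mul_top] at h1
    · exact lt_irrefl _ h1
    · simpa using ⟨h.ratio_mem.1, h'.ratio_mem.1⟩
  · intro hfin
    refine lt_of_le_of_lt (le_self_add.trans (lintegral_sideWeight_add h h' s u).le) ?_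
    exact ENNReal.mul_lt_top ENNReal.ofReal_lt_top hfin

variable (μ) in
-- Record values are nonnegative, so monotonicity holds for exponents of either sign; u - γ' may be
-- negative.
lemma recordTail_le_of_le (s : ℝ) {v u : ℝ} (hvu : v ≤ u) : recordTail μ s v ≤ recordTail μ s u := by
  refine ENNReal.tsum_le_tsum fun n => ?_
  gcongr
  refine lintegral_mono_ae ?_
  filter_upwards [recordLaw_ae_nonneg μ (n + 1)] with t ht
  gcongr

lemma toReal_lintegral_sideWeight (h : IsStepLaw μ γ δ b) (h' : IsStepLaw ν γ' δ' b') {s u : ℝ}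
    (hfin : recordGen μ s u < ⊤) :
    (∫⁻ p, sideWeight s u p.1 p.2 ∂(seqLaw μ).prod (seqLaw ν)).toReal =
      γ / δ * ((recordGen μ s u).toReal - 1) -
        (1 - γ' / δ') * (γ / δ * ((recordGen μ s (u - γ')).toReal - 1)) := by
  have hside := (lintegral_sideWeight_lt_top_iff h h' s u).2 hfin
  rw [recordGen_eq_one_add, ENNReal.add_lt_top] at hfin
  have hfin' : recordTail μ s (u - γ') < ⊤ :=
    (recordTail_le_of_le μ s (by linarith [h'.gamma_pos])).trans_lt hfin.2
  have hr := h.ratio_mem; have hr' := h'.ratio_mem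
  have key := congrArg ENNReal.toReal (lintegral_sideWeight_add h h' s u)
  rw [ENNReal.toReal_add hside.ne (by finiteness), ENNReal.toReal_mul, ENNReal.toReal_mul,
    ENNReal.toReal_mul, ENNReal.toReal_ofReal hr.1.le, ENNReal.toReal_ofReal (by linarith)] at key
  rw [recordGen_eq_one_add, recordGen_eq_one_add, ENNReal.toReal_add ENNReal.one_ne_top hfin.2.ne,
    ENNReal.toReal_add ENNReal.one_ne_top hfin'.ne, ENNReal.toReal_one]
  linear_combination key

lemma lintegral_pairWeight (h : IsStepLaw μ γ δ b) (h' : IsStepLaw ν γ' δ' b') (s u : ℝ) :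
    ∫⁻ p, pairWeight s u p.1 p.2 ∂(seqLaw μ).prod (seqLaw ν) =
      ENNReal.ofReal (γ / δ) * ENNReal.ofReal (γ' / δ') +
        (∫⁻ p, sideWeight s u p.1 p.2 ∂(seqLaw μ).prod (seqLaw ν) +
          ∫⁻ p, sideWeight s u p.1 p.2 ∂(seqLaw ν).prod (seqLaw μ)) := by
  have hm : MeasurableSet ((nonposAlways : Set (ℕ → ℝ)) ×ˢ (nonposAlways : Set (ℕ → ℝ))) :=
    measurableSet_nonposAlways.prod measurableSet_nonposAlways
  unfold pairWeight
  rw [lintegral_add_left (f := fun p => (nonposAlways ×ˢ nonposAlways).indicator 1 p)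
    (measurable_one.indicator hm), lintegral_add_left (measurable_sideWeight s u),
    lintegral_indicator_one hm, Measure.prod_prod, h.measure_nonposAlways,
    h'.measure_nonposAlways, ← Measure.prod_swap (μ := seqLaw μ),
    lintegral_map (measurable_sideWeight s u) measurable_swap]
  rfl

/-- The transform of the two-sided maximum and its location is finite exactly when both
one-sided conditions hold. -/
theorem lintegral_pairWeight_lt_top_iff (h : IsStepLaw μ γ δ b) (h' : IsStepLaw ν γ' δ' b')
    {s u : ℝ} (hs1 : s < 1) (hu : 0 ≤ u) :
    ∫⁻ p, pairWeight s u p.1 p.2 ∂(seqLaw μ).prod (seqLaw ν) < ⊤ ↔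
      ENNReal.ofReal s * expTransform μ u < 1 ∧ ENNReal.ofReal s * expTransform ν u < 1 := by
  rw [lintegral_pairWeight h h', ENNReal.add_lt_top, ENNReal.add_lt_top,
    lintegral_sideWeight_lt_top_iff h h', lintegral_sideWeight_lt_top_iff h' h,
    recordGen_lt_top_iff μ hs1 hu, recordGen_lt_top_iff ν hs1 hu]
  exact and_iff_right (by finiteness)

/-- The transform of the two-sided maximum and its location. -/
theorem toReal_lintegral_pairWeight (h : IsStepLaw μ γ δ b) (h' : IsStepLaw ν γ' δ' b')
    {s u : ℝ} (hfin : recordGen μ s u < ⊤) (hfin' : recordGen ν s u < ⊤) :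
    (∫⁻ p, pairWeight s u p.1 p.2 ∂(seqLaw μ).prod (seqLaw ν)).toReal =
      γ / δ * (γ' / δ') +
        (γ / δ * ((recordGen μ s u).toReal - 1) -
          (1 - γ' / δ') * (γ / δ * ((recordGen μ s (u - γ')).toReal - 1)) +
        (γ' / δ' * ((recordGen ν s u).toReal - 1) -
          (1 - γ / δ) * (γ' / δ' * ((recordGen ν s (u - γ)).toReal - 1)))) := by
  have h1 := (lintegral_sideWeight_lt_top_iff h h' s u).2 hfin
  have h2 := (lintegral_sideWeight_lt_top_iff h' h s u).2 hfin'
  rw [lintegral_pairWeight h h', ENNReal.toReal_add (by finiteness)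
    (ENNReal.add_lt_top.2 ⟨h1, h2⟩).ne, ENNReal.toReal_add h1.ne h2.ne, ENNReal.toReal_mul,
    ENNReal.toReal_ofReal h.ratio_mem.1.le, ENNReal.toReal_ofReal h'.ratio_mem.1.le,
    toReal_lintegral_sideWeight h h' hfin, toReal_lintegral_sideWeight h' h hfin']

end Pair

/-! ### Spitzer's formula for the record generating function -/

variable (μ : Measure ℝ) [IsProbabilityMeasure μ]

lemma recordGen_lt_top_of_le {s v u : ℝ} (hvu : v ≤ u) (h : recordGen μ s u < ⊤) :
    recordGen μ s v < ⊤ := by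
  refine lt_of_le_of_lt ?_ h
  rw [recordGen_eq_one_add, recordGen_eq_one_add]
  gcongr
  exact recordTail_le_of_le μ s hvu

/-- The term with p = (n, 0) in Spitzer's identity is this transform itself, as the record law at
time 0 is the unit mass at 0. -/
lemma expTransform_restrict_walkLaw_lt_top {s v : ℝ} (hs : 0 < s) (h : recordGen μ s v < ⊤)
    (n : ℕ) : expTransform ((walkLaw μ (n + 1)).restrict (Set.Ioi 0)) v < ⊤ := by
  have h1 : ENNReal.ofReal s ^ (n + 1) * expTransform (recordLaw μ (n + 1)) v < ⊤ :=
    lt_of_le_of_lt (ENNReal.le_tsum (f := fun n => ENNReal.ofReal s ^ n *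
      expTransform (recordLaw μ n) v) (n + 1)) h
  have h2 : expTransform (recordLaw μ (n + 1)) v < ⊤ :=
    (ENNReal.lt_top_of_mul_ne_top_right h1.ne (pow_ne_zero _ (by simpa using hs)))
  have h3 := sum_expTransform_recordLaw μ v n
  have h4 := Finset.single_le_sum (f := fun p : ℕ × ℕ =>
    expTransform ((walkLaw μ (p.1 + 1)).restrict (Set.Ioi 0)) v *
        expTransform (recordLaw μ p.2) v) (fun _ _ => zero_le)
    (show (n, 0) ∈ Finset.HasAntidiagonal.antidiagonal n by simp)
  simp only [recordLaw_zero, expTransform_dirac_zero, mul_one] at h4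
  rw [h3] at h4
  exact h4.trans_lt (ENNReal.mul_lt_top (by finiteness) h2)

/-- Spitzer's formula for the generating function of the record transforms. -/
theorem exp_tsum_eq_recordGen {s v : ℝ} (hs : 0 < s) (h : recordGen μ s v < ⊤) :
    Summable (fun n : ℕ => s ^ (n + 1) / ((n + 1 : ℕ) : ℝ) *
      (expTransform ((walkLaw μ (n + 1)).restrict (Set.Ioi 0)) v).toReal) ∧
    Real.exp (∑' n : ℕ, s ^ (n + 1) / ((n + 1 : ℕ) : ℝ) *
      (expTransform ((walkLaw μ (n + 1)).restrict (Set.Ioi 0)) v).toReal) =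
        (recordGen μ s v).toReal := by
  have hterm : ∀ n, ENNReal.ofReal s ^ n * expTransform (recordLaw μ n) v < ⊤ := fun n =>
    lt_of_le_of_lt (ENNReal.le_tsum n) h
  have hg : ∀ n, expTransform (recordLaw μ n) v < ⊤ := fun n =>
    (ENNReal.lt_top_of_mul_ne_top_right (hterm n).ne (pow_ne_zero _ (by simpa using hs)))
  have ha := expTransform_restrict_walkLaw_lt_top μ hs h
  have key := exp_tsum_eq_tsum_of_recursion
    (g := fun n => (ENNReal.ofReal s ^ n * expTransform (recordLaw μ n) v).toReal)
    (b := fun n => s ^ (n + 1) * (expTransform ((walkLaw μ (n + 1)).restrict (Set.Ioi 0)) v).toReal)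
    (by simp [recordLaw_zero, expTransform_dirac_zero]) (fun n => ENNReal.toReal_nonneg)
    (fun n => by positivity) (fun n => ?_) (ENNReal.summable_toReal h.ne)
  · have e : ∀ n : ℕ, s ^ (n + 1) *
        (expTransform ((walkLaw μ (n + 1)).restrict (Set.Ioi 0)) v).toReal / ((n : ℝ) + 1) =
        s ^ (n + 1) / ((n + 1 : ℕ) : ℝ) *
      (expTransform ((walkLaw μ (n + 1)).restrict (Set.Ioi 0)) v).toReal := by
      intro n; push_cast; ring
    simp_rw [e] at key
    refine ⟨key.1, key.2.trans ?_⟩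
    rw [recordGen, ENNReal.tsum_toReal_eq fun n => (hterm n).ne]
  · have h3 := congrArg ENNReal.toReal (sum_expTransform_recordLaw μ v n)
    rw [ENNReal.toReal_sum fun p _ => (ENNReal.mul_lt_top (ha _) (hg _)).ne] at h3
    simp only [ENNReal.toReal_mul, ENNReal.toReal_pow, ENNReal.toReal_ofReal hs.le] at h3 ⊢
    have h4 : ((n : ℝ≥0∞) + 1).toReal = (n : ℝ) + 1 := by
      rw [← Nat.cast_succ, ENNReal.toReal_natCast, Nat.cast_succ]
    rw [h4] at h3
    calc _ = s ^ (n + 1) * ∑ p ∈ Finset.HasAntidiagonal.antidiagonal n,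
          (expTransform ((walkLaw μ (p.1 + 1)).restrict (Set.Ioi 0)) v).toReal *
            (expTransform (recordLaw μ p.2) v).toReal := by
          rw [Finset.mul_sum]
          refine Finset.sum_congr rfl fun p hp => ?_
          rw [← Finset.HasAntidiagonal.mem_antidiagonal.1 hp]
          ring
      _ = _ := by rw [h3]; ring

end RandomWalk

/-! ### From the lattice path to the walks at concave corners -/

namespace RandomWalk

open scoped ENNReal

/-- A path which is nonincreasing along the edges in `D` and nondecreasing along the others is
dominated by its values at the turns. -/
lemma exists_turn_ge {T : ℕ → ℝ} {D C : ℕ → Prop}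
    (hdec : ∀ n, D n → T (n + 1) ≤ T n) (hinc : ∀ n, ¬ D n → T n ≤ T (n + 1))
    (hinf : ∀ n, ∃ m, n < m ∧ D m) (hC0 : C 0) (hC : ∀ n, ¬ D n → D (n + 1) → C (n + 1)) (n : ℕ) :
    ∃ w, C w ∧ T n ≤ T w := by
  induction n with
  | zero => exact ⟨0, hC0, le_rfl⟩
  | succ n ih =>
    by_cases hD : D n
    · obtain ⟨w, hw, hle⟩ := ih
      exact ⟨w, hw, (hdec n hD).trans hle⟩
    -- After a rising edge the path is followed up to its next falling edge; it does not decrease on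
    -- the way, and it turns there.
    · classical
      have hex : ∃ k, D (n + 1 + k) := by
        obtain ⟨m, hm, hDm⟩ := hinf n
        exact ⟨m - (n + 1), by rwa [Nat.add_sub_cancel' hm]⟩
      have hmin : ∀ k < Nat.find hex, ¬ D (n + 1 + k) := fun k hk => Nat.find_min hex hk
      have hmono : ∀ k ≤ Nat.find hex, T (n + 1) ≤ T (n + 1 + k) := by
        intro k
        induction k with
        | zero => exact fun _ => le_rfl
        | succ k ihk => exact fun hk => (ihk (by omega)).trans (hinc _ (hmin k (by omega)))
      refine ⟨n + 1 + Nat.find hex, ?_, hmono _ le_rfl⟩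
      rcases hk : Nat.find hex with _ | k
      · have := Nat.find_spec hex
        rw [hk] at this
        exact hC n hD this
      · have := Nat.find_spec hex
        rw [hk] at this
        exact hC (n + 1 + k) (hmin k (by omega)) this

/-- A substrate with corners as required and nonnegative edge variables. -/
structure IsGoodPath (φ : ℤ → ℤ × ℤ) (ξ ξ' : ℤ → ℝ) : Prop where
  substrate : IsSubstrate φ
  corner_zero : IsConcaveCorner φ 0
  right : ∀ m : ℤ, ∃ z, m < z ∧ IsConcaveCorner φ z
  left : ∀ m : ℤ, ∃ z, z < m ∧ IsConcaveCorner φ z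
  nonneg : ∀ z, 0 ≤ ξ z
  nonneg' : ∀ z, 0 ≤ ξ' z

variable {φ : ℤ → ℤ × ℤ} {ξ ξ' : ℤ → ℝ}

lemma substrateWalk_zero : substrateWalk φ ξ ξ' 0 = 0 := by simp [substrateWalk]

lemma substrateWalk_succ (n : ℕ) : substrateWalk φ ξ ξ' ((n + 1 : ℕ) : ℤ) =
    substrateWalk φ ξ ξ' n + edgeIncrement φ ξ ξ' ((n + 1 : ℕ) : ℤ) := by
  have h1 : (0 : ℤ) ≤ ((n + 1 : ℕ) : ℤ) := by omega
  have h2 : (0 : ℤ) ≤ (n : ℤ) := by omega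
  rw [substrateWalk, substrateWalk, if_pos h1, if_pos h2]
  have : Finset.Ioc (0 : ℤ) ((n + 1 : ℕ) : ℤ) = insert ((n + 1 : ℕ) : ℤ) (Finset.Ioc 0 (n : ℤ)) := by
    ext k; simp only [Finset.mem_Ioc, Finset.mem_insert]; omega
  rw [this, Finset.sum_insert (by simp), add_comm]

lemma substrateWalk_neg (n : ℕ) :
    substrateWalk φ ξ ξ' (-(n : ℤ)) = ∑ k ∈ Finset.Ioc (-(n : ℤ)) 0, edgeIncrement φ ξ ξ' k := by
  rcases n with _ | n
  · simp [substrateWalk]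
  · rw [substrateWalk, if_neg (by omega)]

lemma substrateWalk_neg_succ (n : ℕ) : substrateWalk φ ξ ξ' (-((n + 1 : ℕ) : ℤ)) =
    substrateWalk φ ξ ξ' (-(n : ℤ)) + edgeIncrement φ ξ ξ' (-(n : ℤ)) := by
  rw [substrateWalk_neg, substrateWalk_neg]
  have : Finset.Ioc (-((n + 1 : ℕ) : ℤ)) 0 = insert (-(n : ℤ)) (Finset.Ioc (-(n : ℤ)) 0) := by
    ext k; simp only [Finset.mem_Ioc, Finset.mem_insert]; omega
  rw [this, Finset.sum_insert (by simp), add_comm]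

namespace IsGoodPath

variable (h : IsGoodPath φ ξ ξ')
include h

lemma infinite_right : {j : ℕ | IsConcaveCorner φ (j : ℤ)}.Infinite := by
  refine Set.infinite_of_forall_exists_gt fun n => ?_
  obtain ⟨z, hz, hc⟩ := h.right n
  lift z to ℕ using by omega
  exact ⟨z, hc, by exact_mod_cast hz⟩

lemma infinite_left : {j : ℕ | IsConcaveCorner φ (-(j : ℤ))}.Infinite := by
  refine Set.infinite_of_forall_exists_gt fun n => ?_
  obtain ⟨z, hz, hc⟩ := h.left (-n)
  obtain ⟨m, rfl⟩ : ∃ m : ℕ, z = -(m : ℤ) := ⟨z.natAbs, by omega⟩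
  exact ⟨m, hc, by omega⟩

omit h in
lemma _root_.RandomWalk.corner_natCast (φ : ℤ → ℤ × ℤ) (n : ℕ) :
    corner φ n = (Nat.nth (fun j : ℕ => IsConcaveCorner φ (j : ℤ)) n : ℤ) := by
  simp [corner]

lemma corner_zero_eq : corner φ 0 = 0 := by
  have := corner_natCast φ 0
  rw [Nat.cast_zero] at this
  rw [this, Nat.nth_zero_of_zero (by simpa using h.corner_zero), Nat.cast_zero]

lemma corner_neg_natCast (n : ℕ) :
    corner φ (-n) = -(Nat.nth (fun j : ℕ => IsConcaveCorner φ (-(j : ℤ))) n : ℤ) := by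
  rcases n with _ | n
  · rw [Nat.nth_zero_of_zero (by simpa using h.corner_zero)]
    simpa using h.corner_zero_eq
  · rw [corner, if_neg (by omega), Int.natAbs_neg, Int.natAbs_natCast]

omit h in
lemma _root_.RandomWalk.exists_corner_right {w : ℕ} (hw : IsConcaveCorner φ w) : ∃ k, corner φ k = w := by
  classical
  refine ⟨(Nat.count (fun j : ℕ => IsConcaveCorner φ (j : ℤ)) w : ℕ), ?_⟩
  rw [corner_natCast, Nat.nth_count (p := fun j : ℕ => IsConcaveCorner φ (j : ℤ)) hw]

lemma exists_corner_left {w : ℕ} (hw : IsConcaveCorner φ (-(w : ℤ))) :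
    ∃ k, corner φ k = -(w : ℤ) := by
  classical
  refine ⟨-(Nat.count (fun j : ℕ => IsConcaveCorner φ (-(j : ℤ))) w : ℕ), ?_⟩
  rw [h.corner_neg_natCast, Nat.nth_count (p := fun j : ℕ => IsConcaveCorner φ (-(j : ℤ))) hw]

/-- To the right of the origin, horizontal edges lower the walk and vertical ones raise it. To the
left, read away from the origin, the roles are exchanged. On both sides a change from rising to
falling is a concave corner. -/
lemma exists_corner_ge (z : ℤ) :
    ∃ k, substrateWalk φ ξ ξ' z ≤ substrateWalk φ ξ ξ' (corner φ k) := by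
  obtain ⟨n, rfl | rfl⟩ := z.eq_nat_or_neg
  · refine Exists.elim (exists_turn_ge (T := fun n => substrateWalk φ ξ ξ' n)
      (D := fun n : ℕ => φ ((n + 1 : ℕ) : ℤ) - φ n = (1, 0))
      (C := fun n => IsConcaveCorner φ n) ?_ ?_ ?_ ?_ ?_ n) ?_
    · intro n hn
      simp only [substrateWalk_succ]
      have e : ((n + 1 : ℕ) : ℤ) - 1 = n := by push_cast; ring
      rw [edgeIncrement, if_pos (by omega), e, if_pos hn]
      linarith [h.nonneg' ((n + 1 : ℕ) : ℤ)]
    · intro n hn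
      simp only [substrateWalk_succ]
      have e : ((n + 1 : ℕ) : ℤ) - 1 = n := by push_cast; ring
      rw [edgeIncrement, if_pos (by omega), e, if_neg hn]
      linarith [h.nonneg ((n + 1 : ℕ) : ℤ)]
    · intro n
      obtain ⟨z, hz, hc⟩ := h.right n
      lift z to ℕ using by omega
      exact ⟨z, by exact_mod_cast hz, by simpa using hc.2⟩
    · simpa using h.corner_zero
    · intro n hn hn'
      refine ⟨?_, by simpa using hn'⟩
      have := (h.substrate.2 n).resolve_right (by simpa using hn)
      simpa using this
    · rintro w ⟨hw, hle⟩
      obtain ⟨k, hk⟩ := exists_corner_right hw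
      exact ⟨k, hk ▸ hle⟩
  · refine Exists.elim (exists_turn_ge (T := fun n => substrateWalk φ ξ ξ' (-(n : ℤ)))
      (D := fun n : ℕ => φ (-(n : ℤ)) - φ (-(n : ℤ) - 1) = (0, -1))
      (C := fun n => IsConcaveCorner φ (-(n : ℤ))) ?_ ?_ ?_ ?_ ?_ n) ?_
    · intro n hn
      simp only [substrateWalk_neg_succ]
      have e : φ (-(n : ℤ) - 1) - φ (-(n : ℤ)) ≠ (-1, 0) := by
        rw [← neg_sub, hn]; simp
      rw [edgeIncrement, if_neg (by omega), if_neg e]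
      linarith [h.nonneg (-(n : ℤ))]
    · intro n hn
      simp only [substrateWalk_neg_succ]
      have e : φ (-(n : ℤ) - 1) - φ (-(n : ℤ)) = (-1, 0) := by
        have := h.substrate.2 (-(n : ℤ) - 1)
        rw [sub_add_cancel] at this
        rw [← neg_sub, this.resolve_left hn]; simp
      rw [edgeIncrement, if_neg (by omega), if_pos e]
      linarith [h.nonneg' (-(n : ℤ))]
    · intro n
      obtain ⟨z, hz, hc⟩ := h.left (-n)
      obtain ⟨m, rfl⟩ : ∃ m : ℕ, z = -(m : ℤ) := ⟨z.natAbs, by omega⟩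
      exact ⟨m, by omega, hc.1⟩
    · simpa using h.corner_zero
    · intro n hn hn'
      refine ⟨hn', ?_⟩
      have := h.substrate.2 (-(n : ℤ) - 1)
      rw [sub_add_cancel] at this
      have e : -((n + 1 : ℕ) : ℤ) = -(n : ℤ) - 1 := by push_cast; ring
      rw [e, sub_add_cancel]
      exact this.resolve_left hn
    · rintro w ⟨hw, hle⟩
      obtain ⟨k, hk⟩ := h.exists_corner_left hw
      exact ⟨k, hk ▸ hle⟩

lemma walk_cornerStep_right (n : ℕ) :
    walk (cornerStep φ ξ ξ' 1) n = substrateWalk φ ξ ξ' (corner φ n) := by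
  have := Finset.sum_range_sub (fun n : ℕ => substrateWalk φ ξ ξ' (corner φ n)) n
  simp only [Nat.cast_zero, h.corner_zero_eq, substrateWalk_zero, sub_zero] at this
  rw [← this, walk]
  refine Finset.sum_congr rfl fun k _ => ?_
  simp [cornerStep]

lemma walk_cornerStep_left (n : ℕ) :
    walk (cornerStep φ ξ ξ' (-1)) n = substrateWalk φ ξ ξ' (corner φ (-n)) := by
  have := Finset.sum_range_sub (fun n : ℕ => substrateWalk φ ξ ξ' (corner φ (-n))) n
  simp only [Nat.cast_zero, neg_zero, h.corner_zero_eq, substrateWalk_zero, sub_zero] at this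
  rw [← this, walk]
  refine Finset.sum_congr rfl fun k _ => ?_
  simp [cornerStep]

lemma twoSided_cornerStep (k : ℤ) :
    twoSided (cornerStep φ ξ ξ' 1) (cornerStep φ ξ ξ' (-1)) k =
      substrateWalk φ ξ ξ' (corner φ k) := by
  obtain ⟨n, rfl | rfl⟩ := k.eq_nat_or_neg
  · rw [twoSided_natCast, h.walk_cornerStep_right]
  · rw [twoSided_neg_natCast, h.walk_cornerStep_left]

lemma isMaxCorner_iff (k : ℤ) : IsMaxCorner φ ξ ξ' k ↔
    ∀ j, twoSided (cornerStep φ ξ ξ' 1) (cornerStep φ ξ ξ' (-1)) j ≤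
      twoSided (cornerStep φ ξ ξ' 1) (cornerStep φ ξ ξ' (-1)) k := by
  simp only [h.twoSided_cornerStep]
  refine ⟨fun hk j => hk _, fun hk z => ?_⟩
  obtain ⟨j, hj⟩ := h.exists_corner_ge z
  exact hj.trans (hk j)

omit h in
lemma _root_.RandomWalk.isGreatest_of_isMaxCorner {k : ℤ} (hk : IsMaxCorner φ ξ ξ' k) :
    IsGreatest (Set.range (substrateWalk φ ξ ξ')) (substrateWalk φ ξ ξ' (corner φ k)) :=
  ⟨⟨_, rfl⟩, by rintro _ ⟨z, rfl⟩; exact hk z⟩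

omit h in
lemma _root_.RandomWalk.globalMax_eq {k : ℤ} (hk : IsMaxCorner φ ξ ξ' k) :
    globalMax φ ξ ξ' = substrateWalk φ ξ ξ' (corner φ k) :=
  (isGreatest_of_isMaxCorner hk).csSup_eq

lemma existsUnique_isMaxCorner
    (hreg : IsRegularPair (cornerStep φ ξ ξ' 1) (cornerStep φ ξ ξ' (-1))) :
    ∃! k, IsMaxCorner φ ξ ξ' k := by
  simpa only [h.isMaxCorner_iff] using hreg.existsUnique_max

lemma pairWeight_eq {s u : ℝ} (hs : 0 ≤ s)
    (hreg : IsRegularPair (cornerStep φ ξ ξ' 1) (cornerStep φ ξ ξ' (-1))) :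
    pairWeight s u (cornerStep φ ξ ξ' 1) (cornerStep φ ξ ξ' (-1)) =
      ENNReal.ofReal (s ^ (globalArgmax φ ξ ξ').natAbs * Real.exp (u * globalMax φ ξ ξ')) := by
  have hex := (h.existsUnique_isMaxCorner hreg).exists
  have harg : IsMaxCorner φ ξ ξ' (globalArgmax φ ξ ξ') := by
    rw [globalArgmax, dif_pos hex]
    exact hex.choose_spec
  rw [hreg.pairWeight_eq ((h.isMaxCorner_iff _).1 harg), h.twoSided_cornerStep,
    ← globalMax_eq harg, ENNReal.ofReal_mul (by positivity), ENNReal.ofReal_pow hs]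

end IsGoodPath

/-! ### Absence of atoms in the step laws -/

section Atoms

variable {Ω : Type*} [MeasurableSpace Ω] {P : Measure Ω}

lemma measure_eq_null_of_indepFun [IsProbabilityMeasure P] {U W : Ω → ℝ} (hU : Measurable U)
    (hW : Measurable W) (h : IndepFun U W P) (hatom : ∀ c, P.map U {c} = 0) :
    P {ω | U ω = W ω} = 0 := by
  have hm : MeasurableSet {p : ℝ × ℝ | p.1 = p.2} := measurableSet_eq_fun measurable_fst measurable_snd
  have e : {ω | U ω = W ω} = (fun ω => (U ω, W ω)) ⁻¹' {p : ℝ × ℝ | p.1 = p.2} := rfl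
  have := Measure.isProbabilityMeasure_map (μ := P) hU.aemeasurable
  have := Measure.isProbabilityMeasure_map (μ := P) hW.aemeasurable
  rw [e, ← Measure.map_apply (hU.prodMk hW) hm,
    (indepFun_iff_map_prod_eq_prod_map_map hU.aemeasurable hW.aemeasurable).1 h,
    Measure.prod_apply_symm hm]
  refine (lintegral_congr fun w => ?_).trans lintegral_zero
  have : (fun x : ℝ => (x, w)) ⁻¹' {p : ℝ × ℝ | p.1 = p.2} = {w} := by ext; simp
  rw [this]
  exact hatom w

lemma measure_add_sum_eq_null [IsProbabilityMeasure P] {ι : Type*} {Y : ι → Ω → ℝ}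
    (hY : ∀ i, Measurable (Y i)) (hind : iIndepFun Y P) {i : ι} (hatom : ∀ c, P.map (Y i) {c} = 0)
    {T : Finset ι} (hi : i ∉ T) (c : ℝ) : P {ω | Y i ω + ∑ j ∈ T, Y j ω = c} = 0 := by
  have h1 : IndepFun (Y i) (fun ω => c - ∑ j ∈ T, Y j ω) P := by
    have := (hind.indepFun_finsetSum_of_notMem hY hi).symm.comp measurable_id
      (show Measurable fun t : ℝ => c - t by fun_prop)
    have e : (fun ω => c - ∑ j ∈ T, Y j ω) = (fun t : ℝ => c - t) ∘ ∑ j ∈ T, Y j := by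
      ext ω; simp
    rw [e]
    exact this
  have := measure_eq_null_of_indepFun (hY i) (by fun_prop) h1 hatom
  simpa only [eq_sub_iff_add_eq] using this

end Atoms

end RandomWalk

namespace RandomWalk

open scoped ENNReal

lemma expMeasure_singleton (r c : ℝ) : expMeasure r {c} = 0 :=
  withDensity_absolutelyContinuous _ _ (measure_singleton c)

lemma expMeasure_Iio_zero (r : ℝ) : expMeasure r (Set.Iio 0) = 0 := by
  rw [expMeasure, gammaMeasure, withDensity_apply _ measurableSet_Iio]
  exact lintegral_gammaPDF_of_nonpos le_rfl

section Atoms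

variable {Ω : Type*} [MeasurableSpace Ω] {P : Measure Ω}

lemma ae_nonneg_of_hasLaw_expMeasure {X : Ω → ℝ} {r : ℝ} (h : HasLaw X (expMeasure r) P) :
    ∀ᵐ ω ∂P, 0 ≤ X ω := by
  have h1 := expMeasure_Iio_zero r
  rw [← h.map_eq, Measure.map_apply_of_aemeasurable h.aemeasurable measurableSet_Iio] at h1
  rw [ae_iff]
  simpa [Set.preimage] using h1

variable {φ : Ω → ℤ → ℤ × ℤ} {ξ ξ' : ℤ → Ω → ℝ}

lemma map_neg_singleton {X : Ω → ℝ} (hX : Measurable X) (h : ∀ c, P.map X {c} = 0) (c : ℝ) :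
    P.map (fun ω => -X ω) {c} = 0 := by
  have h1 := h (-c)
  rw [Measure.map_apply hX (measurableSet_singleton _)] at h1
  rw [Measure.map_apply (by fun_prop) (measurableSet_singleton _), ← h1]
  congr 1
  ext ω
  simp [neg_eq_iff_eq_neg]

/-- The index of the edge variable attached to the edge `k`, which is of the second kind exactly
for `k ∈ A`. -/
noncomputable def edgeIndex (A : Finset ℤ) (k : ℤ) : ℤ ⊕ ℤ := if k ∈ A then Sum.inr k else Sum.inl k

lemma edgeIndex_injective (A : Finset ℤ) : Function.Injective (edgeIndex A) := by
  intro i j h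
  unfold edgeIndex at h
  split_ifs at h <;> simpa using h

/-- The path leaves the concave corner at the origin horizontally, so the summand -η' 1 occurs
whatever the shape. The finite set A of horizontal edges encodes the rest of the shape. -/
lemma sum_Ioc_zero_edgeIncrement (ψ : ℤ → ℤ × ℤ) (η η' : ℤ → ℝ) (hψ : IsConcaveCorner ψ 0)
    {z : ℤ} (hz : 1 ≤ z) : ∃ A : Finset ℤ,
      Sum.inr 1 ∉ (Finset.Ioc 1 z).image (edgeIndex A) ∧
      ∑ k ∈ Finset.Ioc 0 z, edgeIncrement ψ η η' k = Sum.elim η (-η') (Sum.inr 1) +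
        ∑ j ∈ (Finset.Ioc 1 z).image (edgeIndex A), Sum.elim η (-η') j := by
  classical
  refine ⟨(Finset.Ioc 0 z).filter fun k => ψ k - ψ (k - 1) = (1, 0), ?_, ?_⟩
  · simp only [Finset.mem_image, Finset.mem_Ioc, edgeIndex, not_exists, not_and]
    intro k hk
    split_ifs
    · simp only [Sum.inr.injEq]; omega
    · simp
  · have e : Finset.Ioc 0 z = insert 1 (Finset.Ioc 1 z) := by
      ext k; simp only [Finset.mem_Ioc, Finset.mem_insert]; omega
    have e1 : edgeIncrement ψ η η' 1 = -η' 1 := by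
      have := hψ.2
      rw [zero_add] at this
      rw [edgeIncrement, if_pos le_rfl, sub_self, if_pos this]
    rw [Finset.sum_image fun _ _ _ _ h => edgeIndex_injective _ h]
    conv_lhs => rw [e, Finset.sum_insert (by simp), e1]
    congr 1
    refine Finset.sum_congr rfl fun k hk => ?_
    have hk' := Finset.mem_Ioc.1 hk
    have hk0 : 0 < k := by omega
    rw [edgeIncrement, if_pos (by omega), edgeIndex]
    by_cases h : ψ k - ψ (k - 1) = (1, 0) <;> simp [h, hk0, hk'.2]

/-- The edge into the origin is vertical, so on the left the summand that always occurs is -η 0. -/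
lemma sum_Ioc_edgeIncrement_zero (ψ : ℤ → ℤ × ℤ) (η η' : ℤ → ℝ) (hψ : IsConcaveCorner ψ 0)
    {z : ℤ} (hz : z < 0) : ∃ A : Finset ℤ,
      Sum.inl 0 ∉ (Finset.Ioo z 0).image (edgeIndex A) ∧
      ∑ k ∈ Finset.Ioc z 0, edgeIncrement ψ η η' k = Sum.elim (-η) η' (Sum.inl 0) +
        ∑ j ∈ (Finset.Ioo z 0).image (edgeIndex A), Sum.elim (-η) η' j := by
  classical
  refine ⟨(Finset.Ioc z 0).filter fun k => ψ (k - 1) - ψ k = (-1, 0), ?_, ?_⟩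
  · simp only [Finset.mem_image, Finset.mem_Ioo, edgeIndex, not_exists, not_and]
    intro k hk
    split_ifs
    · simp
    · simp only [Sum.inl.injEq]; omega
  · have e : Finset.Ioc z 0 = insert 0 (Finset.Ioo z 0) := by
      ext k; simp only [Finset.mem_Ioc, Finset.mem_Ioo, Finset.mem_insert]; omega
    have e1 : edgeIncrement ψ η η' 0 = -η 0 := by
      have h1 : ψ (0 - 1) - ψ 0 ≠ (-1, 0) := by
        rw [← neg_sub, hψ.1]; simp
      rw [edgeIncrement, if_neg (by omega), if_neg h1]
    rw [Finset.sum_image fun _ _ _ _ h => edgeIndex_injective _ h]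
    conv_lhs => rw [e, Finset.sum_insert (by simp), e1]
    congr 1
    refine Finset.sum_congr rfl fun k hk => ?_
    have hk' := Finset.mem_Ioo.1 hk
    rw [edgeIncrement, if_neg (by omega), edgeIndex]
    by_cases h : ψ (k - 1) - ψ k = (-1, 0) <;> simp [h, hk'.1, hk'.2.le]

lemma cornerStep_right_eq {ψ : ℤ → ℤ × ℤ} {η η' : ℤ → ℝ} (h : IsGoodPath ψ η η') :
    ∃ z : ℤ, 1 ≤ z ∧ cornerStep ψ η η' 1 0 = ∑ k ∈ Finset.Ioc 0 z, edgeIncrement ψ η η' k := by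
  refine ⟨corner ψ 1, ?_, ?_⟩
  · have h1 := corner_natCast ψ 1
    have h2 := Nat.nth_strictMono h.infinite_right Nat.zero_lt_one
    rw [Nat.cast_one] at h1
    omega
  · have h2 := Nat.nth_strictMono h.infinite_right Nat.zero_lt_one
    have h1 := corner_natCast ψ 1
    rw [Nat.cast_one] at h1
    simp only [cornerStep, Nat.cast_zero, mul_zero, zero_add, mul_one, h.corner_zero_eq,
      substrateWalk_zero, sub_zero]
    rw [substrateWalk, if_pos (by omega)]

lemma cornerStep_left_eq {ψ : ℤ → ℤ × ℤ} {η η' : ℤ → ℝ} (h : IsGoodPath ψ η η') :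
    ∃ z : ℤ, z < 0 ∧ cornerStep ψ η η' (-1) 0 = ∑ k ∈ Finset.Ioc z 0, edgeIncrement ψ η η' k := by
  have h1 := h.corner_neg_natCast 1
  have h2 := Nat.nth_strictMono h.infinite_left Nat.zero_lt_one
  rw [Nat.cast_one] at h1
  refine ⟨corner ψ (-1), by omega, ?_⟩
  simp only [cornerStep, Nat.cast_zero, mul_zero, zero_add, mul_one, h.corner_zero_eq,
    substrateWalk_zero, sub_zero]
  rw [substrateWalk, if_neg (by omega)]

/-- The random path has only countably many possible shapes (z, A) up to its first corner. For each
fixed shape the step is a sum of distinct independent variables, one of them atomless, so a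
countable union of null sets covers the event. -/
lemma measure_cornerStep_right_eq_null [IsProbabilityMeasure P]
    (hgood : ∀ᵐ ω ∂P, IsGoodPath (φ ω) (fun z => ξ z ω) (fun z => ξ' z ω))
    (hξ : ∀ z, Measurable (ξ z)) (hξ' : ∀ z, Measurable (ξ' z))
    (hind : iIndepFun (Sum.elim ξ ξ' : ℤ ⊕ ℤ → Ω → ℝ) P) (hatom : ∀ c, P.map (ξ' 1) {c} = 0)
    (c : ℝ) :
    P {ω | cornerStep (φ ω) (fun z => ξ z ω) (fun z => ξ' z ω) 1 0 = c} = 0 := by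
  let Y : ℤ ⊕ ℤ → Ω → ℝ := fun i ω => Sum.elim (fun z => ξ z ω) (-fun z => ξ' z ω) i
  have hY : ∀ i, Measurable (Y i) := by
    rintro (z | z)
    exacts [hξ z, (hξ' z).neg]
  have hYind : iIndepFun Y P := by
    have := hind.comp (fun i (t : ℝ) => Sum.elim (fun _ : ℤ => t) (fun _ : ℤ => -t) i) (by
      rintro (z | z)
      exacts [measurable_id, measurable_neg])
    convert this using 1
    ext i ω
    rcases i with z | z <;> simp [Y]
  have hYatom : ∀ c, P.map (Y (Sum.inr 1)) {c} = 0 := map_neg_singleton (hξ' 1) hatom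
  have hnull : P (⋃ (z : ℤ) (A : Finset ℤ), {ω | Sum.inr 1 ∉ (Finset.Ioc 1 z).image (edgeIndex A) ∧
      Y (Sum.inr 1) ω + ∑ j ∈ (Finset.Ioc 1 z).image (edgeIndex A), Y j ω = c}) = 0 := by
    refine measure_iUnion_null fun z => measure_iUnion_null fun A => ?_
    by_cases hmem : Sum.inr 1 ∈ (Finset.Ioc 1 z).image (edgeIndex A)
    · simp [hmem]
    · simpa only [hmem, not_false_eq_true, true_and] using
        measure_add_sum_eq_null hY hYind hYatom hmem c
  refine measure_mono_null_ae ?_ hnull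
  filter_upwards [hgood] with ω hω (hc : cornerStep _ _ _ _ _ = c)
  obtain ⟨z, hz, he⟩ := cornerStep_right_eq hω
  obtain ⟨A, hA, hsum⟩ := sum_Ioc_zero_edgeIncrement (φ ω) (fun z => ξ z ω) (fun z => ξ' z ω)
    hω.corner_zero hz
  refine Set.mem_iUnion.2 ⟨z, Set.mem_iUnion.2 ⟨A, hA, ?_⟩⟩
  rw [← hc, he, hsum]

lemma measure_cornerStep_left_eq_null [IsProbabilityMeasure P]
    (hgood : ∀ᵐ ω ∂P, IsGoodPath (φ ω) (fun z => ξ z ω) (fun z => ξ' z ω))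
    (hξ : ∀ z, Measurable (ξ z)) (hξ' : ∀ z, Measurable (ξ' z))
    (hind : iIndepFun (Sum.elim ξ ξ' : ℤ ⊕ ℤ → Ω → ℝ) P) (hatom : ∀ c, P.map (ξ 0) {c} = 0)
    (c : ℝ) :
    P {ω | cornerStep (φ ω) (fun z => ξ z ω) (fun z => ξ' z ω) (-1) 0 = c} = 0 := by
  let Y : ℤ ⊕ ℤ → Ω → ℝ := fun i ω => Sum.elim (-fun z => ξ z ω) (fun z => ξ' z ω) i
  have hY : ∀ i, Measurable (Y i) := by
    rintro (z | z)
    exacts [(hξ z).neg, hξ' z]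
  have hYind : iIndepFun Y P := by
    have := hind.comp (fun i (t : ℝ) => Sum.elim (fun _ : ℤ => -t) (fun _ : ℤ => t) i) (by
      rintro (z | z)
      exacts [measurable_neg, measurable_id])
    convert this using 1
    ext i ω
    rcases i with z | z <;> simp [Y]
  have hYatom : ∀ c, P.map (Y (Sum.inl 0)) {c} = 0 := map_neg_singleton (hξ 0) hatom
  have hnull : P (⋃ (z : ℤ) (A : Finset ℤ), {ω | Sum.inl 0 ∉ (Finset.Ioo z 0).image (edgeIndex A) ∧
      Y (Sum.inl 0) ω + ∑ j ∈ (Finset.Ioo z 0).image (edgeIndex A), Y j ω = c}) = 0 := by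
    refine measure_iUnion_null fun z => measure_iUnion_null fun A => ?_
    by_cases hmem : Sum.inl 0 ∈ (Finset.Ioo z 0).image (edgeIndex A)
    · simp [hmem]
    · simpa only [hmem, not_false_eq_true, true_and] using
        measure_add_sum_eq_null hY hYind hYatom hmem c
  refine measure_mono_null_ae ?_ hnull
  filter_upwards [hgood] with ω hω (hc : cornerStep _ _ _ _ _ = c)
  obtain ⟨z, hz, he⟩ := cornerStep_left_eq hω
  obtain ⟨A, hA, hsum⟩ := sum_Ioc_edgeIncrement_zero (φ ω) (fun z => ξ z ω) (fun z => ξ' z ω)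
    hω.corner_zero hz
  refine Set.mem_iUnion.2 ⟨z, Set.mem_iUnion.2 ⟨A, hA, ?_⟩⟩
  rw [← hc, he, hsum]

/-! ### Transfer from path space to random variables -/

lemma expTransform_map {X : Ω → ℝ} (hX : AEMeasurable X P) {v : ℝ}
    (hint : Integrable (fun ω => Real.exp (v * X ω)) P) :
    expTransform (P.map X) v = ENNReal.ofReal (∫ ω, Real.exp (v * X ω) ∂P) := by
  rw [expTransform, lintegral_map' (by fun_prop) hX,
    ofReal_integral_eq_lintegral_ofReal hint (ae_of_all _ fun ω => (Real.exp_pos _).le)]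

lemma isStepLaw_of_stepAssumptions {X : Ω → ℝ} (hX : AEMeasurable X P) {c γ δ : ℝ}
    (h : StepAssumptions P X c γ δ) (hatom : ∀ t, P {ω | X ω = t} = 0) :
    IsStepLaw (P.map X) γ δ (P.real {ω | 0 < X ω}) where
  delta_pos := h.delta_pos
  b_pos := h.prob_pos
  gamma_pos := h.gamma_least.1.1
  right_tail := h.right_tail
  cramer := by
    rw [expTransform_map hX h.gamma_least.1.2.1, h.gamma_least.1.2.2, ENNReal.ofReal_one]
  noAtoms t := by
    rw [Measure.map_apply_of_aemeasurable hX (measurableSet_singleton _)]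
    exact hatom t

lemma mul_expTransform_lt_one_iff {X : Ω → ℝ} (hX : AEMeasurable X P) {s v : ℝ} (hs : 0 ≤ s)
    (hint : Integrable (fun ω => Real.exp (v * X ω)) P) :
    ENNReal.ofReal s * expTransform (P.map X) v < 1 ↔ s * ∫ ω, Real.exp (v * X ω) ∂P < 1 := by
  rw [expTransform_map hX hint, ← ENNReal.ofReal_mul hs, ENNReal.ofReal_lt_one]

lemma map_seq_eq_seqLaw [IsProbabilityMeasure P] {X : ℕ → Ω → ℝ} (hind : iIndepFun X P)
    (hid : ∀ n, IdentDistrib (X n) (X 0) P P) :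
    P.map (fun ω n => X n ω) = seqLaw (P.map (X 0)) := by
  rw [hind.map_fun_eq_infinitePi_map₀' fun n => (hid n).aemeasurable_fst, seqLaw]
  congr 1
  ext1 n
  exact (hid n).map_eq

/-- On S_n ≤ 0 the exponential of v max(0, S_n) is 1, so subtracting P(S_n ≤ 0) leaves E[e^{v S_n};
S_n > 0]. Finiteness of that part is needed for the Bochner integral to have its intended value. -/
lemma exponentTerm_eq [IsProbabilityMeasure P] {X : ℕ → Ω → ℝ} (hind : iIndepFun X P)
    (hid : ∀ n, IdentDistrib (X n) (X 0) P P) (s v : ℝ) (n : ℕ)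
    (hfin : expTransform ((walkLaw (P.map (X 0)) n).restrict (Set.Ioi 0)) v < ⊤) :
    exponentTerm P X s v n = s ^ n / (n : ℝ) *
      (expTransform ((walkLaw (P.map (X 0)) n).restrict (Set.Ioi 0)) v).toReal := by
  have hXm : AEMeasurable (fun ω n => X n ω) P :=
    aemeasurable_pi_iff.2 fun n => (hid n).aemeasurable_fst
  have hμ : IsProbabilityMeasure (P.map (X 0)) :=
    Measure.isProbabilityMeasure_map (hid 0).aemeasurable_fst
  have hSm : AEMeasurable (partialSum X n) P := (measurable_walk n).comp_aemeasurable hXm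
  have hlaw : P.map (partialSum X n) = walkLaw (P.map (X 0)) n := by
    rw [walkLaw, ← map_seq_eq_seqLaw hind hid, AEMeasurable.map_map_of_aemeasurable
      (by fun_prop) hXm]
    rfl
  set L := walkLaw (P.map (X 0)) n with hL
  have e1 : ∫ ω, Real.exp (v * max 0 (partialSum X n ω)) ∂P = ∫ t, Real.exp (v * max 0 t) ∂L := by
    rw [← hlaw, integral_map hSm (by fun_prop)]
  have e2 : P.real {ω | partialSum X n ω ≤ 0} = L.real (Set.Iic 0) := by
    rw [← hlaw, map_measureReal_apply_of_aemeasurable hSm measurableSet_Iic]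
    rfl
  have hpos : Set.EqOn (fun t => Real.exp (v * max 0 t)) (fun t => Real.exp (v * t)) (Set.Ioi 0) :=
    fun t ht => by simp only [max_eq_right (le_of_lt (Set.mem_Ioi.1 ht))]
  have hneg : Set.EqOn (fun t => Real.exp (v * max 0 t)) (fun _ => 1) (Set.Iic 0) :=
    fun t ht => by simp [max_eq_left (Set.mem_Iic.1 ht)]
  have hint1 : IntegrableOn (fun t => Real.exp (v * t)) (Set.Ioi 0) L := by
    refine ⟨by fun_prop, ?_⟩
    rw [hasFiniteIntegral_iff_ofReal (ae_of_all _ fun t => (Real.exp_pos _).le)]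
    exact hfin
  have hint1' : IntegrableOn (fun t => Real.exp (v * max 0 t)) (Set.Ioi 0) L :=
    hint1.congr_fun hpos.symm measurableSet_Ioi
  have hint2 : IntegrableOn (fun t => Real.exp (v * max 0 t)) (Set.Iic 0) L :=
    (integrableOn_const (measure_ne_top _ _)).congr_fun hneg.symm measurableSet_Iic
  have e3 : ∫ t, Real.exp (v * max 0 t) ∂L =
      (expTransform (L.restrict (Set.Ioi 0)) v).toReal + L.real (Set.Iic 0) := by
    rw [← setIntegral_univ, ← Set.Ioi_union_Iic (a := (0 : ℝ)),
      setIntegral_union (Set.Iic_disjoint_Ioi le_rfl).symm measurableSet_Iic hint1' hint2,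
      setIntegral_congr_fun measurableSet_Ioi hpos, setIntegral_congr_fun measurableSet_Iic hneg,
      integral_eq_lintegral_of_nonneg_ae (ae_of_all _ fun t => (Real.exp_pos _).le) (by fun_prop)]
    simp [expTransform]
  rw [exponentTerm, e1, e2, e3, add_sub_cancel_right]

/-- Spitzer's formula for a sequence of random variables. -/
lemma phiTransform_eq [IsProbabilityMeasure P] {X : ℕ → Ω → ℝ} (hind : iIndepFun X P)
    (hid : ∀ n, IdentDistrib (X n) (X 0) P P) {s v : ℝ} (hs : 0 < s) (γ δ : ℝ)
    (h : recordGen (P.map (X 0)) s v < ⊤) :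
    Summable (fun n : ℕ => exponentTerm P X s v (n + 1)) ∧
      phiTransform P X γ δ s v = γ / δ * ((recordGen (P.map (X 0)) s v).toReal - 1) := by
  have hμ : IsProbabilityMeasure (P.map (X 0)) :=
    Measure.isProbabilityMeasure_map (hid 0).aemeasurable_fst
  have e : ∀ n : ℕ, exponentTerm P X s v (n + 1) = _ := fun n =>
    exponentTerm_eq hind hid s v (n + 1) (expTransform_restrict_walkLaw_lt_top _ hs h n)
  have key := exp_tsum_eq_recordGen (P.map (X 0)) hs h
  simp only [← e] at key
  exact ⟨key.1, by rw [phiTransform, key.2]⟩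

end Atoms

end RandomWalk

/-! ### The main theorem -/

open RandomWalk in
theorem mainTheorem7 {Ω : Type*} [MeasurableSpace Ω] (P : Measure Ω) [IsProbabilityMeasure P]
    (a : ℝ) (ha : 0 < a)
    -- the (random or deterministic) substrate
    (φ : Ω → ℤ → ℤ × ℤ) (hφ_meas : Measurable φ)
    (hφ : ∀ᵐ ω ∂P, IsSubstrate (φ ω) ∧ IsConcaveCorner (φ ω) 0 ∧
      (∀ m : ℤ, ∃ z, m < z ∧ IsConcaveCorner (φ ω) z) ∧
      (∀ m : ℤ, ∃ z, z < m ∧ IsConcaveCorner (φ ω) z))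
    -- the exponential variables, independent of each other and of the substrate
    (ξ ξ' : ℤ → Ω → ℝ)
    (hξ_meas : ∀ z, Measurable (ξ z)) (hξ'_meas : ∀ z, Measurable (ξ' z))
    (hξ_law : ∀ z, HasLaw (ξ z) (expMeasure (rhoParam a)) P)
    (hξ'_law : ∀ z, HasLaw (ξ' z) (expMeasure (1 - rhoParam a)) P)
    (hξ_indep : iIndepFun (Sum.elim ξ ξ' : ℤ ⊕ ℤ → Ω → ℝ) P)
    (hφξ_indep : IndepFun φ (fun ω i => (Sum.elim ξ ξ' : ℤ ⊕ ℤ → Ω → ℝ) i ω) P)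
    -- the steps between successive concave corners on either side
    (Xp Xm : ℕ → Ω → ℝ)
    (hXp : Xp = fun n ω => cornerStep (φ ω) (fun z => ξ z ω) (fun z => ξ' z ω) 1 n)
    (hXm : Xm = fun n ω => cornerStep (φ ω) (fun z => ξ z ω) (fun z => ξ' z ω) (-1) n)
    -- two independent random walks, each with independent identically distributed steps
    (hXp_indep : iIndepFun Xp P) (hXp_ident : ∀ n, IdentDistrib (Xp n) (Xp 0) P P)
    (hXm_indep : iIndepFun Xm P) (hXm_ident : ∀ n, IdentDistrib (Xm n) (Xm 0) P P)
    (hsides : IndepFun (fun ω n => Xp n ω) (fun ω n => Xm n ω) P)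
    -- the assumptions on the step distributions
    (c γp δp γm δm : ℝ) (hc : 0 < c)
    (hp : StepAssumptions P (Xp 0) c γp δp) (hm : StepAssumptions P (Xm 0) c γm δm)
    -- the maximum and its location
    (M : Ω → ℝ) (Z : Ω → ℤ)
    (hM : M = fun ω => globalMax (φ ω) (fun z => ξ z ω) (fun z => ξ' z ω))
    (hZ : Z = fun ω => globalArgmax (φ ω) (fun z => ξ z ω) (fun z => ξ' z ω)) :
    (∀ᵐ ω ∂P, (∃! k : ℤ, IsMaxCorner (φ ω) (fun z => ξ z ω) (fun z => ξ' z ω) k) ∧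
      IsGreatest (Set.range (substrateWalk (φ ω) (fun z => ξ z ω) (fun z => ξ' z ω))) (M ω)) ∧
    ∀ s ∈ Set.Ioo (0 : ℝ) 1, ∀ u ∈ Set.Icc (0 : ℝ) c,
      (Integrable (fun ω => s ^ (Z ω).natAbs * Real.exp (u * M ω)) P ↔
        s * ∫ ω, Real.exp (u * Xp 0 ω) ∂P < 1 ∧ s * ∫ ω, Real.exp (u * Xm 0 ω) ∂P < 1) ∧
      (s * ∫ ω, Real.exp (u * Xp 0 ω) ∂P < 1 → s * ∫ ω, Real.exp (u * Xm 0 ω) ∂P < 1 →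
        Summable (fun n : ℕ => exponentTerm P Xp s u (n + 1)) ∧
        Summable (fun n : ℕ => exponentTerm P Xp s (u - γm) (n + 1)) ∧
        Summable (fun n : ℕ => exponentTerm P Xm s u (n + 1)) ∧
        Summable (fun n : ℕ => exponentTerm P Xm s (u - γp) (n + 1)) ∧
        ∫ ω, s ^ (Z ω).natAbs * Real.exp (u * M ω) ∂P =
          γp / δp * (γm / δm) +
            phiTransform P Xp γp δp s u -
            (1 - γm / δm) * phiTransform P Xp γp δp s (u - γm) +
            phiTransform P Xm γm δm s u -
            (1 - γp / δp) * phiTransform P Xm γm δm s (u - γp)) := by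
  have hgood : ∀ᵐ ω ∂P, IsGoodPath (φ ω) (fun z => ξ z ω) (fun z => ξ' z ω) := by
    filter_upwards [hφ, ae_all_iff.2 fun z => ae_nonneg_of_hasLaw_expMeasure (hξ_law z),
      ae_all_iff.2 fun z => ae_nonneg_of_hasLaw_expMeasure (hξ'_law z)] with ω h1 h2 h3
    exact ⟨h1.1, h1.2.1, h1.2.2.1, h1.2.2.2, h2, h3⟩
  have hXp_ae : ∀ n, AEMeasurable (Xp n) P := fun n => (hXp_ident n).aemeasurable_fst
  have hXm_ae : ∀ n, AEMeasurable (Xm n) P := fun n => (hXm_ident n).aemeasurable_fst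
  have hatomp : ∀ t, P {ω | Xp 0 ω = t} = 0 := by
    subst hXp
    exact measure_cornerStep_right_eq_null hgood hξ_meas hξ'_meas hξ_indep
      fun c => by rw [(hξ'_law 1).map_eq]; exact expMeasure_singleton _ c
  have hatomm : ∀ t, P {ω | Xm 0 ω = t} = 0 := by
    subst hXm
    exact measure_cornerStep_left_eq_null hgood hξ_meas hξ'_meas hξ_indep
      fun c => by rw [(hξ_law 0).map_eq]; exact expMeasure_singleton _ c
  have hlp := isStepLaw_of_stepAssumptions (hXp_ae 0) hp hatomp
  have hlm := isStepLaw_of_stepAssumptions (hXm_ae 0) hm hatomm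
  have : IsProbabilityMeasure (P.map (Xp 0)) := Measure.isProbabilityMeasure_map (hXp_ae 0)
  have : IsProbabilityMeasure (P.map (Xm 0)) := Measure.isProbabilityMeasure_map (hXm_ae 0)
  have hseqp : AEMeasurable (fun ω n => Xp n ω) P := aemeasurable_pi_iff.2 hXp_ae
  have hseqm : AEMeasurable (fun ω n => Xm n ω) P := aemeasurable_pi_iff.2 hXm_ae
  have hpair : AEMeasurable (fun ω => ((fun n => Xp n ω), fun n => Xm n ω)) P :=
    hseqp.prodMk hseqm
  have hjoint : P.map (fun ω => ((fun n => Xp n ω), fun n => Xm n ω)) =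
      (seqLaw (P.map (Xp 0))).prod (seqLaw (P.map (Xm 0))) := by
    rw [(indepFun_iff_map_prod_eq_prod_map_map hseqp hseqm).1 hsides,
      map_seq_eq_seqLaw hXp_indep hXp_ident, map_seq_eq_seqLaw hXm_indep hXm_ident]
  have hreg : ∀ᵐ ω ∂P, IsRegularPair (cornerStep (φ ω) (fun z => ξ z ω) (fun z => ξ' z ω) 1)
      (cornerStep (φ ω) (fun z => ξ z ω) (fun z => ξ' z ω) (-1)) := by
    have h1 := hlp.ae_isRegularPair hlm
    rw [← hjoint] at h1
    have h2 := ae_of_ae_map hpair h1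
    subst hXp hXm
    exact h2
  refine ⟨?_, fun s hs u hu => ?_⟩
  · filter_upwards [hgood, hreg] with ω h1 h2
    have hex := h1.existsUnique_isMaxCorner h2
    refine ⟨hex, ?_⟩
    obtain ⟨k, hk⟩ := hex.exists
    rw [hM]
    simp only
    rw [globalMax_eq hk]
    exact isGreatest_of_isMaxCorner hk
  have hweight : ∀ᵐ ω ∂P, ENNReal.ofReal (s ^ (Z ω).natAbs * Real.exp (u * M ω)) =
      pairWeight s u (fun n => Xp n ω) (fun n => Xm n ω) := by
    filter_upwards [hgood, hreg] with ω h1 h2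
    subst hXp hXm hM hZ
    exact (h1.pairWeight_eq hs.1.le h2).symm
  have hnonneg : ∀ᵐ ω ∂P, 0 ≤ s ^ (Z ω).natAbs * Real.exp (u * M ω) :=
    ae_of_all _ fun ω => mul_nonneg (pow_nonneg hs.1.le _) (Real.exp_pos _).le
  -- Z is defined by a choice and M by an uncountable-looking supremum along a random path;
  -- measurability is inherited from `pairWeight`, with which the integrand agrees almost surely.
  have hmeas : AEStronglyMeasurable (fun ω => s ^ (Z ω).natAbs * Real.exp (u * M ω)) P := by
    have h1 : AEMeasurable (fun ω => (pairWeight s u (fun n => Xp n ω) (fun n => Xm n ω)).toReal) P :=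
      ((measurable_pairWeight s u).comp_aemeasurable hpair).ennreal_toReal
    refine (h1.congr ?_).aestronglyMeasurable
    filter_upwards [hweight, hnonneg] with ω h2 h3
    rw [← h2, ENNReal.toReal_ofReal h3]
  have hlint : ∫⁻ ω, ENNReal.ofReal (s ^ (Z ω).natAbs * Real.exp (u * M ω)) ∂P =
      ∫⁻ p, pairWeight s u p.1 p.2 ∂(seqLaw (P.map (Xp 0))).prod (seqLaw (P.map (Xm 0))) := by
    rw [lintegral_congr_ae hweight, ← hjoint,
      lintegral_map' (measurable_pairWeight s u).aemeasurable hpair]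
  have hcondp := mul_expTransform_lt_one_iff (hXp_ae 0) hs.1.le (hp.exp_moment u hu)
  have hcondm := mul_expTransform_lt_one_iff (hXm_ae 0) hs.1.le (hm.exp_moment u hu)
  refine ⟨?_, fun h1 h2 => ?_⟩
  · rw [← hcondp, ← hcondm, ← lintegral_pairWeight_lt_top_iff hlp hlm hs.2 hu.1, ← hlint,
      ← hasFiniteIntegral_iff_ofReal hnonneg]
    exact ⟨fun h => h.2, fun h => ⟨hmeas, h⟩⟩
  · have hgp := (recordGen_lt_top_iff (P.map (Xp 0)) hs.2 hu.1).2 (hcondp.2 h1)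
    have hgm := (recordGen_lt_top_iff (P.map (Xm 0)) hs.2 hu.1).2 (hcondm.2 h2)
    -- The shifted exponents u - γm and u - γp may be negative, outside the range of the finiteness
    -- criterion; finiteness comes by comparison with u.
    have hgp' := recordGen_lt_top_of_le (v := u - γm) (P.map (Xp 0))
      (by linarith [hlm.gamma_pos]) hgp
    have hgm' := recordGen_lt_top_of_le (v := u - γp) (P.map (Xm 0))
      (by linarith [hlp.gamma_pos]) hgm
    obtain ⟨s1, e1⟩ := phiTransform_eq hXp_indep hXp_ident hs.1 γp δp hgp
    obtain ⟨s2, e2⟩ := phiTransform_eq hXp_indep hXp_ident hs.1 γp δp hgp'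
    obtain ⟨s3, e3⟩ := phiTransform_eq hXm_indep hXm_ident hs.1 γm δm hgm
    obtain ⟨s4, e4⟩ := phiTransform_eq hXm_indep hXm_ident hs.1 γm δm hgm'
    refine ⟨s1, s2, s3, s4, ?_⟩
    rw [integral_eq_lintegral_of_nonneg_ae hnonneg hmeas, hlint,
      toReal_lintegral_pairWeight hlp hlm hgp hgm, e1, e2, e3, e4]
    ring
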